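/- Let $a=(a_{ij})$ and $b=(b_{ij})$ be the $2\times 2$ payoff matrices of a two-player game. Its Spohn cubic is the ternary cubic $$F_{a,b}=c_1x^2y+c_2x^2z+c_3xy^2+c_4xz^2+c_5y^2z+c_6yz^2+c_7xyz$$ with $c_1=(a_{11}-a_{22})(b_{11}-b_{12})$, $c_2=(a_{11}-a_{21})(b_{22}-b_{11})$, $c_3=(a_{12}-a_{22})(b_{11}-b_{12})$, $c_4=(a_{11}-a_{21})(b_{22}-b_{21})$, $c_5=(a_{12}-a_{22})(b_{21}-b_{12})$, $c_6=(a_{12}-a_{21})(b_{22}-b_{21})$, $c_7=(a_{12}-a_{21})(b_{22}-b_{11})+(a_{11}-a_{22})(b_{21}-b_{12})$. Let $\mathcal I(a,b)$ be the Aronhold invariant of $F_{a,b}$, scaled to be a primitive integer polynomial in the coefficients of the cubic, that is, $$\mathcal I=c_7^4-8c_7^2(c_1c_6+c_2c_5+c_3c_4)+24c_7(c_1c_4c_5+c_2c_3c_6)+16(c_1^2c_6^2+c_2^2c_5^2+c_3^2c_4^2)-16(c_1c_2c_5c_6+c_2c_3c_4c_5+c_1c_3c_4c_6).$$ Let $\mathcal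 D(a,b)$ be the discriminant of $F_{a,b}$, where the discriminant of a ternary cubic $F$ with Hessian determinant $H$ is $-\frac{1}{13824}$ times the determinant of the $6\times 6$ matrix whose rows are the coefficients (with respect to $x^2,xy,xz,y^2,yz,z^2$) of $F_x,F_y,F_z,H_x,H_y,H_z$. With this scaling a Weierstrass cubic has its usual discriminant. Regard $\mathcal I$ and $\mathcal D$ as polynomials over $\mathbb C$ in the eight unknowns $a_{ij},b_{ij}$. Then: 1. $\mathcal I(a,b)$ is irreducible (over $\mathbb C$), has degree $8$, and has exactly $633$ terms. 2. $\mathcal D(a,b)$ has degree $24$ and factors as $$\mathcal D=(a_{11}-a_{12})^2(a_{11}-a_{21})^2(a_{12}-a_{22})^2(a_{21}-a_{22})^2(b_{11}-b_{12})^2(b_{11}-b_{21})^2(b_{12}-b_{22})^2(b_{21}-b_{22})^2\,\mathcal E(a,b),$$ where $\mathcal E(a,b)$ is irreducible (over $\mathbb C$) of degree $8$ with exactly $587$ terms. 3. For all complex $2\times2$ matrices $a,b$, the plane curve $F_{a,b}=0$ in $\mathbb P^2_{\mathbb C}$ is smooth if and only if $\mathcal D(a,b)\neq 0$, and in this case its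 j-invariant exists, is unique, and equals $$j=\frac{\mathcal I(a,b)^3}{\mathcal D(a,b)}.$$ Here the j-invariant of a plane cubic is the usual j-invariant (equal to $1728$ for $y^2=x^3-x$) of an elliptic curve in Weierstrass form that is projectively equivalent to it. -/

import Mathlib

open MvPolynomial

section TernaryCubics

variable {R : Type*} [CommRing R]

/-- The coefficient of `x^i y^j z^k` in a polynomial in the three variables
`x = X 0`, `y = X 1`, `z = X 2`. -/
noncomputable def coeff₃ (F : MvPolynomial (Fin 3) R) (i j k : ℕ) : R :=
  F.coeff (Finsupp.equivFunOnFinite.symm ![i, j, k])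

/-- The Aronhold invariant of a ternary cubic
`a x³ + b y³ + c z³ + a₂ x²y + a₃ x²z + b₁ xy² + b₃ y²z + c₁ xz² + c₂ yz² + m xyz`,
normalized to be a primitive integer polynomial of degree 4 (25 terms) in the ten coefficients
(so it is `-1296` times the expression in the coefficients of the cubic written with
multinomial factors `3` and `6`). -/
noncomputable def aronhold (F : MvPolynomial (Fin 3) R) : R :=
  let a := coeff₃ F 3 0 0
  let b := coeff₃ F 0 3 0
  let c := coeff₃ F 0 0 3
  let a₂ := coeff₃ F 2 1 0
  let a₃ := coeff₃ F 2 0 1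
  let b₁ := coeff₃ F 1 2 0
  let b₃ := coeff₃ F 0 2 1
  let c₁ := coeff₃ F 1 0 2
  let c₂ := coeff₃ F 0 1 2
  let m := coeff₃ F 1 1 1
  m ^ 4 - 8 * m ^ 2 * (b₁ * c₁ + c₂ * a₂ + a₃ * b₃)
    + 24 * m * (a₂ * b₃ * c₁ + a₃ * b₁ * c₂)
    + 16 * (b₁ ^ 2 * c₁ ^ 2 + c₂ ^ 2 * a₂ ^ 2 + a₃ ^ 2 * b₃ ^ 2)
    - 16 * (c₂ * a₂ * a₃ * b₃ + a₃ * b₃ * b₁ * c₁ + b₁ * c₁ * c₂ * a₂)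
    + 24 * m * (a * b₃ * c₂ + b * c₁ * a₃ + c * a₂ * b₁)
    - 48 * (a * b₁ * c₂ ^ 2 + a * c₁ * b₃ ^ 2 + b * a₂ * c₁ ^ 2
        + b * c₂ * a₃ ^ 2 + c * b₃ * a₂ ^ 2 + c * a₃ * b₁ ^ 2)
    + 144 * (b * c * a₂ * a₃ + c * a * b₁ * b₃ + a * b * c₁ * c₂)
    - 216 * a * b * c * m

/-- The Hessian determinant of a ternary form. -/
noncomputable def hessianDet (F : MvPolynomial (Fin 3) R) : MvPolynomial (Fin 3) R :=
  (Matrix.of fun i j : Fin 3 => pderiv i (pderiv j F)).det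

/-- The row of coefficients of a ternary quadric, in the order `x², xy, xz, y², yz, z²`. -/
noncomputable def quadricRow (Q : MvPolynomial (Fin 3) R) : Fin 6 → R :=
  ![coeff₃ Q 2 0 0, coeff₃ Q 1 1 0, coeff₃ Q 1 0 1,
    coeff₃ Q 0 2 0, coeff₃ Q 0 1 1, coeff₃ Q 0 0 2]

/-- The discriminant of a ternary cubic `F`: up to a constant, the resultant of the three
quadrics `∂F/∂x, ∂F/∂y, ∂F/∂z`, given by Sylvester's `6 × 6` determinant, whose rows are the
coefficients of these quadrics and of the three partial derivatives of their Jacobian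
determinant, which is the Hessian determinant of `F`. The constant `-1/13824` makes it a
primitive integer polynomial of degree 12 in the ten coefficients of `F`, with the sign for which
a Weierstrass cubic has its usual discriminant. -/
noncomputable def cubicDiscriminant [Algebra ℚ R] (F : MvPolynomial (Fin 3) R) : R :=
  (-1 / 13824 : ℚ) • (Matrix.of ![quadricRow (pderiv 0 F), quadricRow (pderiv 1 F),
    quadricRow (pderiv 2 F), quadricRow (pderiv 0 (hessianDet F)),
    quadricRow (pderiv 1 (hessianDet F)), quadricRow (pderiv 2 (hessianDet F))]).det

/-- The Spohn cubic of the `2 × 2` game with payoff matrices `a` and `b`, in the variables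
`x = X 0`, `y = X 1`, `z = X 2`. The indices `0, 1 : Fin 2` stand for the strategies `1, 2`. -/
noncomputable def spohnCubic (a b : Matrix (Fin 2) (Fin 2) R) : MvPolynomial (Fin 3) R :=
  C ((a 0 0 - a 1 1) * (b 0 0 - b 0 1)) * X 0 ^ 2 * X 1
  + C ((a 0 0 - a 1 0) * (b 1 1 - b 0 0)) * X 0 ^ 2 * X 2
  + C ((a 0 1 - a 1 1) * (b 0 0 - b 0 1)) * X 0 * X 1 ^ 2
  + C ((a 0 0 - a 1 0) * (b 1 1 - b 1 0)) * X 0 * X 2 ^ 2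
  + C ((a 0 1 - a 1 1) * (b 1 0 - b 0 1)) * X 1 ^ 2 * X 2
  + C ((a 0 1 - a 1 0) * (b 1 1 - b 1 0)) * X 1 * X 2 ^ 2
  + C ((a 0 1 - a 1 0) * (b 1 1 - b 0 0) + (a 0 0 - a 1 1) * (b 1 0 - b 0 1))
      * X 0 * X 1 * X 2

end TernaryCubics

/-- The plane projective curve `F = 0` over `ℂ` is smooth. -/
def IsSmoothPlaneCurve (F : MvPolynomial (Fin 3) ℂ) : Prop :=
  ∀ p : Fin 3 → ℂ, p ≠ 0 → eval p F = 0 → ∃ i, eval p (pderiv i F) ≠ 0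

/-- Two ternary forms define projectively equivalent plane curves: they agree up to an invertible
linear substitution of the variables and a nonzero scalar. -/
def ProjectivelyEquivalent (F G : MvPolynomial (Fin 3) ℂ) : Prop :=
  ∃ (g : Matrix (Fin 3) (Fin 3) ℂ) (c : ℂ), IsUnit g.det ∧ c ≠ 0 ∧
    bind₁ (fun i => ∑ j, C (g i j) * X j) F = C c * G

/-- `j` is a j-invariant of the plane cubic `F = 0` over `ℂ`: it is the j-invariant of an elliptic
curve in Weierstrass form to which the cubic is projectively equivalent. -/
def IsJInvariant (F : MvPolynomial (Fin 3) ℂ) (j : ℂ) : Prop :=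
  ∃ (W : WeierstrassCurve ℂ) (_ : W.IsElliptic),
    ProjectivelyEquivalent F (WeierstrassCurve.Projective.polynomial W) ∧ W.j = j

/-- The eight unknowns: `Sum.inl (i, j)` is `a_ij` and `Sum.inr (i, j)` is `b_ij`. -/
abbrev PayoffVar : Type := (Fin 2 × Fin 2) ⊕ (Fin 2 × Fin 2)

/-- The first payoff matrix with unknown entries. -/
noncomputable def genericA : Matrix (Fin 2) (Fin 2) (MvPolynomial PayoffVar ℂ) :=
  Matrix.of fun i j => X (Sum.inl (i, j))

/-- The second payoff matrix with unknown entries. -/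
noncomputable def genericB : Matrix (Fin 2) (Fin 2) (MvPolynomial PayoffVar ℂ) :=
  Matrix.of fun i j => X (Sum.inr (i, j))

/-- `I(a,b)`: the Aronhold invariant of the Spohn cubic, a polynomial in the payoffs. -/
noncomputable def spohnAronhold : MvPolynomial PayoffVar ℂ :=
  aronhold (spohnCubic genericA genericB)

/-- `D(a,b)`: the discriminant of the Spohn cubic, a polynomial in the payoffs. -/
noncomputable def spohnDiscriminant : MvPolynomial PayoffVar ℂ :=
  cubicDiscriminant (spohnCubic genericA genericB)

/-- The value of a polynomial in the eight unknowns at given payoff matrices. -/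
noncomputable def evalPayoff (a b : Matrix (Fin 2) (Fin 2) ℂ) (f : MvPolynomial PayoffVar ℂ) : ℂ :=
  eval (Sum.elim (fun p => a p.1 p.2) (fun p => b p.1 p.2)) f

/-- The product of the squares of the eight differences of two entries in a row or column of
a payoff matrix. -/
noncomputable def payoffSquares : MvPolynomial PayoffVar ℂ :=
  let a := genericA
  let b := genericB
  (a 0 0 - a 0 1) ^ 2 * (a 0 0 - a 1 0) ^ 2 * (a 0 1 - a 1 1) ^ 2 * (a 1 0 - a 1 1) ^ 2
    * (b 0 0 - b 0 1) ^ 2 * (b 0 0 - b 1 0) ^ 2 * (b 0 1 - b 1 1) ^ 2 * (b 1 0 - b 1 1) ^ 2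

/-! The Spohn cubic passes through the three coordinate points, and its invariants collapse onto two
forms in the payoffs: `X = spohnQuartic` and `Λ = differenceProduct`. Its invariants of degree 4 and
6 are `X² + 48Λ` and `X(X² + 72Λ)`, and the difference of the cube of the first and the square of
the second is `1728 Λ²(X² + 64Λ)`. These are the invariants `c₄`, `c₆`, `Δ` (up to the sign of `c₆`)
of the curve `y² = x³ + (X/4)x² - Λx` with a marked 2-torsion point. Since `Λ²` is the product of
the squared payoff differences, the discriminant factors, and `I` and `E` are the members `c = 48`
and `c = 64` of the pencil `X² + cΛ`.

Every member with `c ≠ 0` is irreducible (`irreducible_spohnPencil`): a substitution of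
affine-linear expressions in `s` that keeps the degree 8 turns it into an Eisenstein polynomial over
`ℂ[t]`. The terms are counted by a Kronecker substitution into one variable, followed by a kernel
computation with sorted lists of exponents and integer coefficients.

Smoothness and `j` are treated for an arbitrary ternary cubic. The Aronhold invariant and the
discriminant have weights 4 and 12 under linear substitutions and specialize to `c₄` and `Δ` on
Weierstrass cubics. A singular point moved to `(0 : 0 : 1)` makes a column of the discriminant
matrix vanish. A smooth cubic has a flex, found by a dimension count for the cubic and its Hessian,
and coordinates adapted to the flex give a Weierstrass equation; then `j = c₄³/Δ` can be read off.
-/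

/-! ### Ternary forms in coordinates and the invariants of the Spohn cubic. -/

section TernaryForms

variable {R : Type*} [CommRing R]

/-- The ternary monomial `r x^i y^j z^k`. -/
noncomputable def ternaryMonomial (i j k : ℕ) (r : R) : MvPolynomial (Fin 3) R :=
  monomial (Finsupp.equivFunOnFinite.symm ![i, j, k]) r

theorem ternaryMonomial_eq (i j k : ℕ) (r : R) :
    ternaryMonomial i j k r = C r * X 0 ^ i * X 1 ^ j * X 2 ^ k := by
  rw [ternaryMonomial, monomial_eq, Finsupp.prod_fintype _ _ (fun _ => pow_zero _),
    Fin.prod_univ_three]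
  simp [mul_assoc]

theorem coeff₃_ternaryMonomial (i j k i' j' k' : ℕ) (r : R) :
    coeff₃ (ternaryMonomial i j k r) i' j' k' = if i = i' ∧ j = j' ∧ k = k' then r else 0 := by
  rw [coeff₃, ternaryMonomial, coeff_monomial]
  congr 1
  simp [Matrix.vecCons_inj]

theorem coeff₃_add (F G : MvPolynomial (Fin 3) R) (i j k : ℕ) :
    coeff₃ (F + G) i j k = coeff₃ F i j k + coeff₃ G i j k := coeff_add _ _ _

/-- The ternary cubic form with given coefficients, in the order used by `aronhold`. -/
noncomputable def ternaryCubic (a b c a₂ a₃ b₁ b₃ c₁ c₂ m : R) : MvPolynomial (Fin 3) R :=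
  C a * X 0 ^ 3 + C b * X 1 ^ 3 + C c * X 2 ^ 3 + C a₂ * X 0 ^ 2 * X 1 + C a₃ * X 0 ^ 2 * X 2
    + C b₁ * X 0 * X 1 ^ 2 + C b₃ * X 1 ^ 2 * X 2 + C c₁ * X 0 * X 2 ^ 2 + C c₂ * X 1 * X 2 ^ 2
    + C m * X 0 * X 1 * X 2

/-- The ternary quadratic form with given coefficients, in the order used by `quadricRow`. -/
noncomputable def ternaryQuadric (q₁ q₂ q₃ q₄ q₅ q₆ : R) : MvPolynomial (Fin 3) R :=
  C q₁ * X 0 ^ 2 + C q₂ * X 0 * X 1 + C q₃ * X 0 * X 2 + C q₄ * X 1 ^ 2 + C q₅ * X 1 * X 2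
    + C q₆ * X 2 ^ 2

theorem ternaryCubic_eq_sum (a b c a₂ a₃ b₁ b₃ c₁ c₂ m : R) :
    ternaryCubic a b c a₂ a₃ b₁ b₃ c₁ c₂ m =
      ternaryMonomial 3 0 0 a + ternaryMonomial 0 3 0 b + ternaryMonomial 0 0 3 c
      + ternaryMonomial 2 1 0 a₂ + ternaryMonomial 2 0 1 a₃ + ternaryMonomial 1 2 0 b₁
      + ternaryMonomial 0 2 1 b₃ + ternaryMonomial 1 0 2 c₁ + ternaryMonomial 0 1 2 c₂
      + ternaryMonomial 1 1 1 m := by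
  simp [ternaryMonomial_eq, ternaryCubic]

theorem ternaryQuadric_eq_sum (q₁ q₂ q₃ q₄ q₅ q₆ : R) :
    ternaryQuadric q₁ q₂ q₃ q₄ q₅ q₆ =
      ternaryMonomial 2 0 0 q₁ + ternaryMonomial 1 1 0 q₂ + ternaryMonomial 1 0 1 q₃
      + ternaryMonomial 0 2 0 q₄ + ternaryMonomial 0 1 1 q₅ + ternaryMonomial 0 0 2 q₆ := by
  simp [ternaryMonomial_eq, ternaryQuadric]

theorem aronhold_ternaryCubic (a b c a₂ a₃ b₁ b₃ c₁ c₂ m : R) :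
    aronhold (ternaryCubic a b c a₂ a₃ b₁ b₃ c₁ c₂ m) =
      m ^ 4 - 8 * m ^ 2 * (b₁ * c₁ + c₂ * a₂ + a₃ * b₃)
        + 24 * m * (a₂ * b₃ * c₁ + a₃ * b₁ * c₂)
        + 16 * (b₁ ^ 2 * c₁ ^ 2 + c₂ ^ 2 * a₂ ^ 2 + a₃ ^ 2 * b₃ ^ 2)
        - 16 * (c₂ * a₂ * a₃ * b₃ + a₃ * b₃ * b₁ * c₁ + b₁ * c₁ * c₂ * a₂)
        + 24 * m * (a * b₃ * c₂ + b * c₁ * a₃ + c * a₂ * b₁)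
        - 48 * (a * b₁ * c₂ ^ 2 + a * c₁ * b₃ ^ 2 + b * a₂ * c₁ ^ 2
            + b * c₂ * a₃ ^ 2 + c * b₃ * a₂ ^ 2 + c * a₃ * b₁ ^ 2)
        + 144 * (b * c * a₂ * a₃ + c * a * b₁ * b₃ + a * b * c₁ * c₂)
        - 216 * a * b * c * m := by
  simp [aronhold, ternaryCubic_eq_sum, coeff₃_add, coeff₃_ternaryMonomial]

theorem quadricRow_ternaryQuadric (q₁ q₂ q₃ q₄ q₅ q₆ : R) :
    quadricRow (ternaryQuadric q₁ q₂ q₃ q₄ q₅ q₆) = ![q₁, q₂, q₃, q₄, q₅, q₆] := by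
  simp [quadricRow, ternaryQuadric_eq_sum, coeff₃_add, coeff₃_ternaryMonomial]

theorem pderiv_zero_ternaryCubic (a b c a₂ a₃ b₁ b₃ c₁ c₂ m : R) :
    pderiv 0 (ternaryCubic a b c a₂ a₃ b₁ b₃ c₁ c₂ m) =
      ternaryQuadric (3 * a) (2 * a₂) (2 * a₃) b₁ m c₁ := by
  simp [ternaryCubic, ternaryQuadric, pderiv_X, Derivation.leibniz_pow,
    map_ofNat (C : R →+* MvPolynomial (Fin 3) R)]
  ring

theorem pderiv_one_ternaryCubic (a b c a₂ a₃ b₁ b₃ c₁ c₂ m : R) :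
    pderiv 1 (ternaryCubic a b c a₂ a₃ b₁ b₃ c₁ c₂ m) =
      ternaryQuadric a₂ (2 * b₁) m (3 * b) (2 * b₃) c₂ := by
  simp [ternaryCubic, ternaryQuadric, pderiv_X, Derivation.leibniz_pow,
    map_ofNat (C : R →+* MvPolynomial (Fin 3) R)]
  ring

theorem pderiv_two_ternaryCubic (a b c a₂ a₃ b₁ b₃ c₁ c₂ m : R) :
    pderiv 2 (ternaryCubic a b c a₂ a₃ b₁ b₃ c₁ c₂ m) =
      ternaryQuadric a₃ m (2 * c₁) b₃ (2 * c₂) (3 * c) := by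
  simp [ternaryCubic, ternaryQuadric, pderiv_X, Derivation.leibniz_pow,
    map_ofNat (C : R →+* MvPolynomial (Fin 3) R)]
  ring

theorem pderiv_zero_ternaryQuadric (q₁ q₂ q₃ q₄ q₅ q₆ : R) :
    pderiv 0 (ternaryQuadric q₁ q₂ q₃ q₄ q₅ q₆) =
      C (2 * q₁) * X 0 + C (q₂) * X 1 + C (q₃) * X 2 := by
  simp [ternaryQuadric, pderiv_X, Derivation.leibniz_pow,
    map_ofNat (C : R →+* MvPolynomial (Fin 3) R)]
  ring

theorem pderiv_one_ternaryQuadric (q₁ q₂ q₃ q₄ q₅ q₆ : R) :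
    pderiv 1 (ternaryQuadric q₁ q₂ q₃ q₄ q₅ q₆) =
      C (q₂) * X 0 + C (2 * q₄) * X 1 + C (q₅) * X 2 := by
  simp [ternaryQuadric, pderiv_X, Derivation.leibniz_pow,
    map_ofNat (C : R →+* MvPolynomial (Fin 3) R)]
  ring

theorem pderiv_two_ternaryQuadric (q₁ q₂ q₃ q₄ q₅ q₆ : R) :
    pderiv 2 (ternaryQuadric q₁ q₂ q₃ q₄ q₅ q₆) =
      C (q₃) * X 0 + C (q₅) * X 1 + C (2 * q₆) * X 2 := by
  simp [ternaryQuadric, pderiv_X, Derivation.leibniz_pow,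
    map_ofNat (C : R →+* MvPolynomial (Fin 3) R)]
  ring

theorem hessianDet_ternaryCubic (a b c a₂ a₃ b₁ b₃ c₁ c₂ m : R) :
    hessianDet (ternaryCubic a b c a₂ a₃ b₁ b₃ c₁ c₂ m) = ternaryCubic
      (24 * a * b₁ * c₁ - 6 * a * m ^ 2 - 8 * a₂ ^ 2 * c₁ + 8 * a₂ * a₃ * m - 8 * a₃ ^ 2 * b₁)
      (24 * b * a₂ * c₂ - 6 * b * m ^ 2 - 8 * a₂ * b₃ ^ 2 - 8 * b₁ ^ 2 * c₂ + 8 * b₁ * b₃ * m)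
      (24 * c * a₃ * b₃ - 6 * c * m ^ 2 - 8 * a₃ * c₂ ^ 2 - 8 * b₃ * c₁ ^ 2 + 8 * c₁ * c₂ * m)
      (72 * a * b * c₁ + 24 * a * b₁ * c₂ - 24 * a * b₃ * m - 24 * b * a₃ ^ 2 - 8 * a₂ ^ 2 * c₂
        + 16 * a₂ * a₃ * b₃ - 8 * a₂ * b₁ * c₁ + 2 * a₂ * m ^ 2)
      (72 * a * c * b₁ + 24 * a * b₃ * c₁ - 24 * a * c₂ * m - 24 * c * a₂ ^ 2 + 16 * a₂ * a₃ * c₂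
        - 8 * a₃ ^ 2 * b₃ - 8 * a₃ * b₁ * c₁ + 2 * a₃ * m ^ 2)
      (72 * a * b * c₂ - 24 * a * b₃ ^ 2 + 24 * b * a₂ * c₁ - 24 * b * a₃ * m - 8 * a₂ * b₁ * c₂
        + 16 * a₃ * b₁ * b₃ - 8 * b₁ ^ 2 * c₁ + 2 * b₁ * m ^ 2)
      (72 * b * c * a₂ + 24 * b * a₃ * c₂ - 24 * b * c₁ * m - 24 * c * b₁ ^ 2 - 8 * a₂ * b₃ * c₂
        - 8 * a₃ * b₃ ^ 2 + 16 * b₁ * b₃ * c₁ + 2 * b₃ * m ^ 2)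
      (72 * a * c * b₃ - 24 * a * c₂ ^ 2 - 24 * c * a₂ * m + 24 * c * a₃ * b₁ + 16 * a₂ * c₁ * c₂
        - 8 * a₃ * b₃ * c₁ - 8 * b₁ * c₁ ^ 2 + 2 * c₁ * m ^ 2)
      (72 * b * c * a₃ - 24 * b * c₁ ^ 2 + 24 * c * a₂ * b₃ - 24 * c * b₁ * m - 8 * a₂ * c₂ ^ 2
        - 8 * a₃ * b₃ * c₂ + 16 * b₁ * c₁ * c₂ + 2 * c₂ * m ^ 2)
      (216 * a * b * c - 24 * a * b₃ * c₂ - 24 * b * a₃ * c₁ - 24 * c * a₂ * b₁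
        + 24 * a₂ * b₃ * c₁ - 8 * a₂ * c₂ * m + 24 * a₃ * b₁ * c₂ - 8 * a₃ * b₃ * m
        - 8 * b₁ * c₁ * m + 2 * m ^ 3) := by
  rw [hessianDet, Matrix.det_fin_three]
  simp only [Matrix.of_apply, pderiv_zero_ternaryCubic, pderiv_one_ternaryCubic,
    pderiv_two_ternaryCubic, pderiv_zero_ternaryQuadric, pderiv_one_ternaryQuadric,
    pderiv_two_ternaryQuadric]
  simp only [ternaryCubic, map_add, map_sub, map_mul, map_pow,
    map_ofNat (C : R →+* MvPolynomial (Fin 3) R)]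
  ring

theorem spohnCubic_eq_ternaryCubic (a b : Matrix (Fin 2) (Fin 2) R) :
    spohnCubic a b = ternaryCubic 0 0 0
      ((a 0 0 - a 1 1) * (b 0 0 - b 0 1)) ((a 0 0 - a 1 0) * (b 1 1 - b 0 0))
      ((a 0 1 - a 1 1) * (b 0 0 - b 0 1)) ((a 0 1 - a 1 1) * (b 1 0 - b 0 1))
      ((a 0 0 - a 1 0) * (b 1 1 - b 1 0)) ((a 0 1 - a 1 0) * (b 1 1 - b 1 0))
      ((a 0 1 - a 1 0) * (b 1 1 - b 0 0) + (a 0 0 - a 1 1) * (b 1 0 - b 0 1)) := by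
  simp only [spohnCubic, ternaryCubic, map_zero]
  ring

/-- The Sylvester matrix of the three partial derivatives of a ternary form and of its Hessian. -/
noncomputable def discriminantMatrix (F : MvPolynomial (Fin 3) R) : Matrix (Fin 6) (Fin 6) R :=
  Matrix.of ![quadricRow (pderiv 0 F), quadricRow (pderiv 1 F),
    quadricRow (pderiv 2 F), quadricRow (pderiv 0 (hessianDet F)),
    quadricRow (pderiv 1 (hessianDet F)), quadricRow (pderiv 2 (hessianDet F))]

theorem cubicDiscriminant_eq [Algebra ℚ R] (F : MvPolynomial (Fin 3) R) :
    cubicDiscriminant F = (-1 / 13824 : ℚ) • (discriminantMatrix F).det := rfl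

/-- Clears the rational constant, so that the determinant computations are integral identities over
any commutative ring. -/
theorem cubicDiscriminant_eq_of_det [Algebra ℚ R] {F : MvPolynomial (Fin 3) R} {d : R}
    (h : (discriminantMatrix F).det = -13824 * d) : cubicDiscriminant F = d := by
  rw [cubicDiscriminant_eq, h, show (-13824 * d : R) = (-13824 : ℚ) • d by
    simp [Algebra.smul_def, map_ofNat (algebraMap ℚ R)], smul_smul]
  norm_num

set_option maxHeartbeats 1000000 in
/-- The discriminant of a cubic through the three coordinate points, in terms of its two
Aronhold invariants. -/
theorem det_discriminantMatrix_of_coordinate_points (c₁ c₂ c₃ c₄ c₅ c₆ m : R) :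
    (discriminantMatrix (ternaryCubic 0 0 0 c₁ c₂ c₃ c₅ c₄ c₆ m)).det =
      -8 * ((m ^ 4 - 8 * m ^ 2 * (c₁ * c₆ + c₂ * c₅ + c₃ * c₄)
          + 24 * m * (c₁ * c₄ * c₅ + c₂ * c₃ * c₆)
          + 16 * ((c₁ * c₆) ^ 2 + (c₂ * c₅) ^ 2 + (c₃ * c₄) ^ 2)
          - 16 * (c₁ * c₆ * (c₂ * c₅) + c₂ * c₅ * (c₃ * c₄) + c₃ * c₄ * (c₁ * c₆))) ^ 3
        - (m ^ 6 - 12 * m ^ 4 * (c₁ * c₆ + c₂ * c₅ + c₃ * c₄)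
          + 36 * m ^ 3 * (c₁ * c₄ * c₅ + c₂ * c₃ * c₆)
          + 48 * m ^ 2 * ((c₁ * c₆) ^ 2 + (c₂ * c₅) ^ 2 + (c₃ * c₄) ^ 2)
          + 24 * m ^ 2 * (c₁ * c₆ * (c₂ * c₅) + c₂ * c₅ * (c₃ * c₄) + c₃ * c₄ * (c₁ * c₆))
          - 144 * m * (c₁ * c₄ * c₅ + c₂ * c₃ * c₆) * (c₁ * c₆ + c₂ * c₅ + c₃ * c₄)
          - 64 * ((c₁ * c₆) ^ 3 + (c₂ * c₅) ^ 3 + (c₃ * c₄) ^ 3)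
          + 96 * (c₁ * c₆ * (c₂ * c₅) * (c₁ * c₆ + c₂ * c₅)
            + c₂ * c₅ * (c₃ * c₄) * (c₂ * c₅ + c₃ * c₄)
            + c₃ * c₄ * (c₁ * c₆) * (c₃ * c₄ + c₁ * c₆))
          + 48 * (c₁ * c₆ * (c₂ * c₅) * (c₃ * c₄))
          + 216 * ((c₁ * c₄ * c₅) ^ 2 + (c₂ * c₃ * c₆) ^ 2)) ^ 2) := by
  rw [discriminantMatrix, hessianDet_ternaryCubic]
  simp only [pderiv_zero_ternaryCubic, pderiv_one_ternaryCubic, pderiv_two_ternaryCubic,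
    quadricRow_ternaryQuadric]
  simp only [mul_zero, zero_mul, zero_add, add_zero, sub_zero, zero_sub]
  simp [Matrix.det_succ_row_zero, Fin.sum_univ_succ, Fin.succAbove]
  ring

/-- The product of the eight differences of two entries in a row or column of a payoff matrix. -/
def differenceProduct (a b : Matrix (Fin 2) (Fin 2) R) : R :=
  (a 0 0 - a 1 0) * (a 0 1 - a 1 1) * (b 0 0 - b 0 1) * (b 1 1 - b 1 0) *
    ((a 0 0 - a 0 1) * (a 1 1 - a 1 0) * (b 0 0 - b 1 0) * (b 1 1 - b 0 1))

/-- The form `X` of bidegree `(2, 2)` in the payoffs such that the Spohn cubic has Aronhold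
invariant `X² + 48 Λ` and discriminant `Λ² (X² + 64 Λ)`, where `Λ` is `differenceProduct`. -/
def spohnQuartic (a b : Matrix (Fin 2) (Fin 2) R) : R :=
  ((a 0 1 - a 1 0) * (b 1 1 - b 0 0) + (a 0 0 - a 1 1) * (b 1 0 - b 0 1)) ^ 2
    - 4 * ((a 0 0 - a 1 1) * (a 0 1 - a 1 0) * ((b 0 0 - b 0 1) * (b 1 1 - b 1 0))
      + (a 0 0 - a 1 0) * (a 0 1 - a 1 1) * ((b 1 1 - b 0 0) * (b 1 0 - b 0 1))
      - 2 * ((a 0 0 - a 1 0) * (a 0 1 - a 1 1) * ((b 0 0 - b 0 1) * (b 1 1 - b 1 0))))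

theorem aronhold_spohnCubic (a b : Matrix (Fin 2) (Fin 2) R) :
    aronhold (spohnCubic a b) = spohnQuartic a b ^ 2 + 48 * differenceProduct a b := by
  rw [spohnCubic_eq_ternaryCubic, aronhold_ternaryCubic, spohnQuartic, differenceProduct]
  ring

/-- The coefficients of the Spohn cubic involve only eight payoff differences, taken here as
independent variables. The other four differences in `Λ` enter through three-term Plücker relations:
`A₁A₄ - A₂A₃` becomes `(a₁₁ - a₁₂)(a₂₂ - a₂₁)` and `B₁B₃ - B₂B₄` becomes `(b₁₁ - b₂₁)(b₂₂ - b₁₂)`.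
-/
theorem det_discriminantMatrix_of_products (A₁ A₂ A₃ A₄ B₁ B₂ B₃ B₄ X L : R)
    (hX : X = (A₄ * B₂ + A₁ * B₄) ^ 2
      - 4 * (A₁ * A₄ * (B₁ * B₃) + A₂ * A₃ * (B₂ * B₄) - 2 * (A₂ * A₃ * (B₁ * B₃))))
    (hL : L = A₂ * A₃ * (B₁ * B₃) * ((A₁ * A₄ - A₂ * A₃) * (B₁ * B₃ - B₂ * B₄))) :
    (discriminantMatrix (ternaryCubic 0 0 0 (A₁ * B₁) (A₂ * B₂) (A₃ * B₁) (A₃ * B₄) (A₂ * B₃)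
      (A₄ * B₃) (A₄ * B₂ + A₁ * B₄))).det = -13824 * (L ^ 2 * (X ^ 2 + 64 * L)) := by
  rw [det_discriminantMatrix_of_coordinate_points]
  -- The two invariants are matched separately, which avoids expanding the degree 12 expression. The
  -- terms in `X⁶` and `X⁴L` then cancel, and `8 · 1728 = 13824`.
  trans -8 * ((X ^ 2 + 48 * L) ^ 3 - (X * (X ^ 2 + 72 * L)) ^ 2)
  · congr 3
    · rw [hX, hL]
      ring
    · rw [hX, hL]
      ring
  · ring

theorem cubicDiscriminant_spohnCubic [Algebra ℚ R] (a b : Matrix (Fin 2) (Fin 2) R) :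
    cubicDiscriminant (spohnCubic a b) =
      differenceProduct a b ^ 2 * (spohnQuartic a b ^ 2 + 64 * differenceProduct a b) := by
  apply cubicDiscriminant_eq_of_det
  rw [spohnCubic_eq_ternaryCubic]
  apply det_discriminantMatrix_of_products
  · rfl
  · rw [differenceProduct]
    ring

end TernaryForms

/-! ### Normalization of the invariants on Weierstrass cubics. -/

section Weierstrass

variable {R : Type*} [CommRing R] (W : WeierstrassCurve R)

theorem weierstrassPolynomial_eq_ternaryCubic :
    WeierstrassCurve.Projective.polynomial W =
      ternaryCubic (-1) 0 (-W.a₆) 0 (-W.a₂) 0 1 (-W.a₄) W.a₃ W.a₁ := by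
  simp only [WeierstrassCurve.Projective.polynomial, ternaryCubic, map_neg, map_one, map_zero]
  ring

theorem aronhold_weierstrassPolynomial :
    aronhold (WeierstrassCurve.Projective.polynomial W) = W.c₄ := by
  rw [weierstrassPolynomial_eq_ternaryCubic, aronhold_ternaryCubic, WeierstrassCurve.c₄,
    WeierstrassCurve.b₂, WeierstrassCurve.b₄]
  ring

set_option maxHeartbeats 1000000 in
theorem cubicDiscriminant_weierstrassPolynomial [Algebra ℚ R] :
    cubicDiscriminant (WeierstrassCurve.Projective.polynomial W) = W.Δ := by
  apply cubicDiscriminant_eq_of_det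
  rw [weierstrassPolynomial_eq_ternaryCubic, discriminantMatrix, hessianDet_ternaryCubic,
    WeierstrassCurve.Δ, WeierstrassCurve.b₂, WeierstrassCurve.b₄, WeierstrassCurve.b₆,
    WeierstrassCurve.b₈]
  simp only [pderiv_zero_ternaryCubic, pderiv_one_ternaryCubic, pderiv_two_ternaryCubic,
    quadricRow_ternaryQuadric]
  simp only [mul_zero, zero_mul, zero_add, add_zero, sub_zero, zero_sub, ne_eq,
    OfNat.ofNat_ne_zero, not_false_eq_true, zero_pow]
  simp [Matrix.det_succ_row_zero, Fin.sum_univ_succ, Fin.succAbove]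
  ring

end Weierstrass

/-- The cubic is singular at `(0 : 0 : 1)`, and so is its Hessian; hence none of the six partial
derivatives contains `z²`. -/
theorem det_discriminantMatrix_of_singular {R : Type*} [CommRing R]
    (a b a₂ a₃ b₁ b₃ m : R) :
    (discriminantMatrix (ternaryCubic a b 0 a₂ a₃ b₁ b₃ 0 0 m)).det = 0 := by
  apply Matrix.det_eq_zero_of_column_eq_zero 5
  intro i
  rw [discriminantMatrix, hessianDet_ternaryCubic]
  simp only [pderiv_zero_ternaryCubic, pderiv_one_ternaryCubic, pderiv_two_ternaryCubic,
    quadricRow_ternaryQuadric]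
  fin_cases i <;> simp

/-! ### Behaviour of the invariants under linear substitutions. -/

section LinearSubstitution

variable {R : Type*} [CommRing R]

/-- The substitution of the linear forms given by the rows of `g` for the variables. -/
noncomputable def linearSubst (g : Matrix (Fin 3) (Fin 3) R) :
    MvPolynomial (Fin 3) R →ₐ[R] MvPolynomial (Fin 3) R :=
  bind₁ fun i => ∑ j, C (g i j) * X j

theorem linearSubst_X (g : Matrix (Fin 3) (Fin 3) R) (i : Fin 3) :
    linearSubst g (X i) = ∑ j, C (g i j) * X j := bind₁_X_right _ _

theorem linearSubst_C (g : Matrix (Fin 3) (Fin 3) R) (r : R) : linearSubst g (C r) = C r :=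
  bind₁_C_right _ _

theorem linearSubst_linearSubst (g h : Matrix (Fin 3) (Fin 3) R) (F : MvPolynomial (Fin 3) R) :
    linearSubst h (linearSubst g F) = linearSubst (g * h) F := by
  have : (linearSubst h).comp (linearSubst g) = linearSubst (g * h) := by
    ext1 i
    simp only [AlgHom.comp_apply, linearSubst_X, map_mul, linearSubst_C, Fin.sum_univ_three,
      Matrix.mul_apply, map_add]
    ring
  exact DFunLike.congr_fun this F

theorem eval_linearSubst (g : Matrix (Fin 3) (Fin 3) R) (p : Fin 3 → R)
    (F : MvPolynomial (Fin 3) R) : eval p (linearSubst g F) = eval (g.mulVec p) F := by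
  have : (aeval p : MvPolynomial (Fin 3) R →ₐ[R] R).comp (linearSubst g) =
      aeval (g.mulVec p) := by
    ext1 i
    simp [linearSubst_X, Matrix.mulVec, dotProduct]
  exact DFunLike.congr_fun this F

theorem pderiv_linearSubst (g : Matrix (Fin 3) (Fin 3) R) (j : Fin 3)
    (F : MvPolynomial (Fin 3) R) :
    pderiv j (linearSubst g F) = ∑ i, C (g i j) * linearSubst g (pderiv i F) := by
  induction F using MvPolynomial.induction_on with
  | C r => simp
  | add F G hF hG => simp only [map_add, hF, hG, mul_add, Finset.sum_add_distrib]
  | mul_X F k hF =>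
    simp only [map_mul, Derivation.leibniz, hF, linearSubst_X, map_add, smul_eq_mul, pderiv_X,
      pderiv_C, Fin.sum_univ_three]
    fin_cases j <;> fin_cases k <;> simp <;> ring

/-- By the chain rule applied twice, the matrix of second derivatives becomes `gᵀ H g`, with the
substitution applied to the entries of `H`. -/
theorem hessianDet_linearSubst (g : Matrix (Fin 3) (Fin 3) R) (F : MvPolynomial (Fin 3) R) :
    hessianDet (linearSubst g F) = C (g.det ^ 2) * linearSubst g (hessianDet F) := by
  have h : (Matrix.of fun i j : Fin 3 => pderiv i (pderiv j (linearSubst g F))) =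
      (g.map C).transpose * (linearSubst g).mapMatrix
        (Matrix.of fun i j : Fin 3 => pderiv i (pderiv j F)) * g.map C := by
    ext1 i j
    simp only [Matrix.of_apply, pderiv_linearSubst, map_add, Derivation.leibniz, pderiv_C,
      smul_eq_mul, mul_zero, add_zero, Matrix.mul_apply, Matrix.transpose_apply, Matrix.map_apply,
      AlgHom.mapMatrix_apply, Fin.sum_univ_three]
    ring
  rw [hessianDet, h, Matrix.det_mul, Matrix.det_mul, Matrix.det_transpose, hessianDet,
    AlgHom.map_det, map_pow, RingHom.map_det, RingHom.mapMatrix_apply]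
  ring

/-- The symmetric square of a `3 × 3` matrix. -/
def symmetricSquare (g : Matrix (Fin 3) (Fin 3) R) : Matrix (Fin 6) (Fin 6) R :=
  let r : Fin 3 → Fin 3 → Fin 6 → R := fun i j =>
    ![g i 0 * g j 0, g i 0 * g j 1 + g i 1 * g j 0, g i 0 * g j 2 + g i 2 * g j 0, g i 1 * g j 1,
      g i 1 * g j 2 + g i 2 * g j 1, g i 2 * g j 2]
  Matrix.of ![r 0 0, r 0 1, r 0 2, r 1 1, r 1 2, r 2 2]

theorem linearSubst_ternaryQuadric (g : Matrix (Fin 3) (Fin 3) R) (q : Fin 6 → R) :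
    linearSubst g (ternaryQuadric (q 0) (q 1) (q 2) (q 3) (q 4) (q 5)) =
      ternaryQuadric (Matrix.vecMul q (symmetricSquare g) 0)
        (Matrix.vecMul q (symmetricSquare g) 1) (Matrix.vecMul q (symmetricSquare g) 2)
        (Matrix.vecMul q (symmetricSquare g) 3) (Matrix.vecMul q (symmetricSquare g) 4)
        (Matrix.vecMul q (symmetricSquare g) 5) := by
  simp only [ternaryQuadric, map_add, map_mul, map_pow, linearSubst_X, linearSubst_C,
    Fin.sum_univ_three, Matrix.vecMul, dotProduct, Fin.sum_univ_six, symmetricSquare,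
    Matrix.of_apply]
  simp
  ring

set_option maxHeartbeats 4000000 in
theorem det_symmetricSquare (g : Matrix (Fin 3) (Fin 3) R) :
    (symmetricSquare g).det = g.det ^ 4 := by
  rw [symmetricSquare, Matrix.det_fin_three]
  simp [Matrix.det_succ_row_zero, Fin.sum_univ_succ, Fin.succAbove]
  ring

theorem eval_ternaryCubic (p : Fin 3 → R) (a b c a₂ a₃ b₁ b₃ c₁ c₂ m : R) :
    eval p (ternaryCubic a b c a₂ a₃ b₁ b₃ c₁ c₂ m) =
      a * p 0 ^ 3 + b * p 1 ^ 3 + c * p 2 ^ 3 + a₂ * p 0 ^ 2 * p 1 + a₃ * p 0 ^ 2 * p 2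
        + b₁ * p 0 * p 1 ^ 2 + b₃ * p 1 ^ 2 * p 2 + c₁ * p 0 * p 2 ^ 2 + c₂ * p 1 * p 2 ^ 2
        + m * p 0 * p 1 * p 2 := by
  simp [ternaryCubic]

theorem eval_ternaryQuadric (p : Fin 3 → R) (q₁ q₂ q₃ q₄ q₅ q₆ : R) :
    eval p (ternaryQuadric q₁ q₂ q₃ q₄ q₅ q₆) =
      q₁ * p 0 ^ 2 + q₂ * p 0 * p 1 + q₃ * p 0 * p 2 + q₄ * p 1 ^ 2 + q₅ * p 1 * p 2
        + q₆ * p 2 ^ 2 := by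
  simp [ternaryQuadric]

/-- The derivative of `F` at the point `p` in the direction `v`. -/
noncomputable def directionalDerivative (F : MvPolynomial (Fin 3) R) (p v : Fin 3 → R) : R :=
  ∑ i, v i * eval p (pderiv i F)

/-- Taylor expansion of a cubic in the coordinates given by the columns `u, v, w` of `g`. -/
theorem linearSubst_ternaryCubic (g : Matrix (Fin 3) (Fin 3) R)
    {F : MvPolynomial (Fin 3) R} {a b c a₂ a₃ b₁ b₃ c₁ c₂ m : R}
    (hF : F = ternaryCubic a b c a₂ a₃ b₁ b₃ c₁ c₂ m) {u v w : Fin 3 → R}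
    (hu : u = fun i => g i 0) (hv : v = fun i => g i 1) (hw : w = fun i => g i 2) :
    linearSubst g F = ternaryCubic (eval u F) (eval v F) (eval w F)
      (directionalDerivative F u v) (directionalDerivative F u w) (directionalDerivative F v u)
      (directionalDerivative F v w) (directionalDerivative F w u) (directionalDerivative F w v)
      (∑ i, v i * directionalDerivative (pderiv i F) u w) := by
  subst hF hu hv hw
  simp only [directionalDerivative, Fin.sum_univ_three, pderiv_zero_ternaryCubic,
    pderiv_one_ternaryCubic, pderiv_two_ternaryCubic, eval_ternaryCubic, eval_ternaryQuadric,
    pderiv_zero_ternaryQuadric, pderiv_one_ternaryQuadric, pderiv_two_ternaryQuadric,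
    map_add, map_mul, eval_C, eval_X, map_ofNat]
  simp only [ternaryCubic, map_add, map_mul, map_pow, linearSubst_X, linearSubst_C,
    Fin.sum_univ_three, map_ofNat (C : R →+* MvPolynomial (Fin 3) R)]
  ring

theorem coeff₃_C_mul (r : R) (F : MvPolynomial (Fin 3) R) (i j k : ℕ) :
    coeff₃ (C r * F) i j k = r * coeff₃ F i j k := coeff_C_mul _ _ _

theorem quadricRow_add (F G : MvPolynomial (Fin 3) R) :
    quadricRow (F + G) = quadricRow F + quadricRow G := by
  simp [quadricRow, coeff₃_add]

theorem quadricRow_C_mul (r : R) (F : MvPolynomial (Fin 3) R) :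
    quadricRow (C r * F) = r • quadricRow F := by
  simp [quadricRow, coeff₃_C_mul]

theorem quadricRow_linearSubst (g : Matrix (Fin 3) (Fin 3) R) (q₁ q₂ q₃ q₄ q₅ q₆ : R) :
    quadricRow (linearSubst g (ternaryQuadric q₁ q₂ q₃ q₄ q₅ q₆)) =
      Matrix.vecMul (quadricRow (ternaryQuadric q₁ q₂ q₃ q₄ q₅ q₆)) (symmetricSquare g) := by
  rw [quadricRow_ternaryQuadric]
  refine (congrArg quadricRow (linearSubst_ternaryQuadric g ![q₁, q₂, q₃, q₄, q₅, q₆])).trans ?_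
  rw [quadricRow_ternaryQuadric]
  ext i
  fin_cases i <;> rfl

theorem quadricRow_pderiv_linearSubst (g : Matrix (Fin 3) (Fin 3) R) {F : MvPolynomial (Fin 3) R}
    {a b c a₂ a₃ b₁ b₃ c₁ c₂ m : R} (hF : F = ternaryCubic a b c a₂ a₃ b₁ b₃ c₁ c₂ m)
    (j : Fin 3) :
    quadricRow (pderiv j (linearSubst g F)) =
      g 0 j • Matrix.vecMul (quadricRow (pderiv 0 F)) (symmetricSquare g)
      + g 1 j • Matrix.vecMul (quadricRow (pderiv 1 F)) (symmetricSquare g)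
      + g 2 j • Matrix.vecMul (quadricRow (pderiv 2 F)) (symmetricSquare g) := by
  subst hF
  simp only [pderiv_linearSubst, Fin.sum_univ_three, quadricRow_add, quadricRow_C_mul,
    pderiv_zero_ternaryCubic, pderiv_one_ternaryCubic, pderiv_two_ternaryCubic,
    quadricRow_linearSubst]

theorem pderiv_C_mul_eq (r : R) (G : MvPolynomial (Fin 3) R) (i : Fin 3) :
    pderiv i (C r * G) = C r * pderiv i G := by
  simp

theorem discriminantMatrix_rows (F : MvPolynomial (Fin 3) R) :
    discriminantMatrix F 0 = quadricRow (pderiv 0 F) ∧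
    discriminantMatrix F 1 = quadricRow (pderiv 1 F) ∧
    discriminantMatrix F 2 = quadricRow (pderiv 2 F) ∧
    discriminantMatrix F 3 = quadricRow (pderiv 0 (hessianDet F)) ∧
    discriminantMatrix F 4 = quadricRow (pderiv 1 (hessianDet F)) ∧
    discriminantMatrix F 5 = quadricRow (pderiv 2 (hessianDet F)) :=
  ⟨rfl, rfl, rfl, rfl, rfl, rfl⟩

/-- The partials of the cubic are mixed by `gᵀ`, those of the Hessian by `(det g)² gᵀ`, and the
coefficients of each quadric are transformed by the symmetric square. With `d = det g` the factors
are `d`, `d⁶ · d` and `d⁴`. -/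
theorem det_discriminantMatrix_linearSubst (g : Matrix (Fin 3) (Fin 3) R)
    (a b c a₂ a₃ b₁ b₃ c₁ c₂ m : R) :
    (discriminantMatrix (linearSubst g (ternaryCubic a b c a₂ a₃ b₁ b₃ c₁ c₂ m))).det =
      g.det ^ 12 * (discriminantMatrix (ternaryCubic a b c a₂ a₃ b₁ b₃ c₁ c₂ m)).det := by
  set d := g.det with hd
  let B : Matrix (Fin 6) (Fin 6) R := Matrix.of
    ![![g 0 0, g 1 0, g 2 0, 0, 0, 0], ![g 0 1, g 1 1, g 2 1, 0, 0, 0],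
      ![g 0 2, g 1 2, g 2 2, 0, 0, 0],
      ![0, 0, 0, d ^ 2 * g 0 0, d ^ 2 * g 1 0, d ^ 2 * g 2 0],
      ![0, 0, 0, d ^ 2 * g 0 1, d ^ 2 * g 1 1, d ^ 2 * g 2 1],
      ![0, 0, 0, d ^ 2 * g 0 2, d ^ 2 * g 1 2, d ^ 2 * g 2 2]]
  have hB : B.det = d ^ 6 * g.det ^ 2 := by
    rw [Matrix.det_fin_three]
    simp [B, Matrix.det_succ_row_zero, Fin.sum_univ_succ, Fin.succAbove]
    ring
  have hM : discriminantMatrix (linearSubst g (ternaryCubic a b c a₂ a₃ b₁ b₃ c₁ c₂ m)) =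
      B * discriminantMatrix (ternaryCubic a b c a₂ a₃ b₁ b₃ c₁ c₂ m) * symmetricSquare g := by
    rw [Matrix.mul_assoc]
    generalize hF : ternaryCubic a b c a₂ a₃ b₁ b₃ c₁ c₂ m = F
    have hH := hessianDet_ternaryCubic a b c a₂ a₃ b₁ b₃ c₁ c₂ m
    rw [hF] at hH
    ext i k
    rw [Matrix.mul_apply, Fin.sum_univ_six]
    simp only [Matrix.mul_apply_eq_vecMul, discriminantMatrix_rows]
    simp only [discriminantMatrix, hessianDet_linearSubst, pderiv_C_mul_eq,
      quadricRow_pderiv_linearSubst g hF.symm, quadricRow_pderiv_linearSubst g hH,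
      quadricRow_C_mul, ← hd]
    fin_cases i <;> simp [B] <;> ring
  rw [hM, Matrix.det_mul, Matrix.det_mul, hB, det_symmetricSquare]
  ring

theorem cubicDiscriminant_linearSubst [Algebra ℚ R] (g : Matrix (Fin 3) (Fin 3) R)
    (a b c a₂ a₃ b₁ b₃ c₁ c₂ m : R) :
    cubicDiscriminant (linearSubst g (ternaryCubic a b c a₂ a₃ b₁ b₃ c₁ c₂ m)) =
      g.det ^ 12 * cubicDiscriminant (ternaryCubic a b c a₂ a₃ b₁ b₃ c₁ c₂ m) := by
  rw [cubicDiscriminant_eq, cubicDiscriminant_eq, det_discriminantMatrix_linearSubst,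
    mul_smul_comm]

theorem hessianDet_C_mul (r : R) (F : MvPolynomial (Fin 3) R) :
    hessianDet (C r * F) = C (r ^ 3) * hessianDet F := by
  simp only [hessianDet, Matrix.det_fin_three, Matrix.of_apply, pderiv_C_mul_eq, map_pow]
  ring

theorem det_discriminantMatrix_C_mul (r : R) (F : MvPolynomial (Fin 3) R) :
    (discriminantMatrix (C r * F)).det = r ^ 12 * (discriminantMatrix F).det := by
  have h : discriminantMatrix (C r * F) = Matrix.of fun i j =>
      (![r, r, r, r ^ 3, r ^ 3, r ^ 3] : Fin 6 → R) i * discriminantMatrix F i j := by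
    ext i j
    simp only [discriminantMatrix, hessianDet_C_mul, pderiv_C_mul_eq, quadricRow_C_mul]
    fin_cases i <;> rfl
  rw [h, Matrix.det_mul_column, Fin.prod_univ_six]
  simp
  ring

theorem cubicDiscriminant_C_mul [Algebra ℚ R] (r : R) (F : MvPolynomial (Fin 3) R) :
    cubicDiscriminant (C r * F) = r ^ 12 * cubicDiscriminant F := by
  rw [cubicDiscriminant_eq, cubicDiscriminant_eq, det_discriminantMatrix_C_mul, mul_smul_comm]

theorem aronhold_C_mul (r : R) (F : MvPolynomial (Fin 3) R) :
    aronhold (C r * F) = r ^ 4 * aronhold F := by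
  simp only [aronhold, coeff₃_C_mul]
  ring

theorem aronhold_linearSubst_diagonal (d : Fin 3 → R) (a b c a₂ a₃ b₁ b₃ c₁ c₂ m : R) :
    aronhold (linearSubst (Matrix.diagonal d) (ternaryCubic a b c a₂ a₃ b₁ b₃ c₁ c₂ m)) =
      (Matrix.diagonal d).det ^ 4 * aronhold (ternaryCubic a b c a₂ a₃ b₁ b₃ c₁ c₂ m) := by
  rw [linearSubst_ternaryCubic _ rfl rfl rfl rfl, aronhold_ternaryCubic, aronhold_ternaryCubic,
    Matrix.det_diagonal, Fin.prod_univ_three]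
  simp only [directionalDerivative, Fin.sum_univ_three, pderiv_zero_ternaryCubic,
    pderiv_one_ternaryCubic, pderiv_two_ternaryCubic, eval_ternaryCubic, eval_ternaryQuadric,
    pderiv_zero_ternaryQuadric, pderiv_one_ternaryQuadric, pderiv_two_ternaryQuadric,
    map_add, map_mul, eval_C, eval_X, map_ofNat]
  simp
  ring

theorem aronhold_linearSubst_transvection {i j : Fin 3} (hij : i ≠ j) (t : R)
    (a b c a₂ a₃ b₁ b₃ c₁ c₂ m : R) :
    aronhold (linearSubst (Matrix.transvection i j t)
      (ternaryCubic a b c a₂ a₃ b₁ b₃ c₁ c₂ m)) =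
      aronhold (ternaryCubic a b c a₂ a₃ b₁ b₃ c₁ c₂ m) := by
  rw [linearSubst_ternaryCubic _ rfl rfl rfl rfl, aronhold_ternaryCubic, aronhold_ternaryCubic]
  simp only [directionalDerivative, Fin.sum_univ_three, pderiv_zero_ternaryCubic,
    pderiv_one_ternaryCubic, pderiv_two_ternaryCubic, eval_ternaryCubic, eval_ternaryQuadric,
    pderiv_zero_ternaryQuadric, pderiv_one_ternaryQuadric, pderiv_two_ternaryQuadric,
    map_add, map_mul, eval_C, eval_X, map_ofNat, Matrix.transvection, Matrix.add_apply,
    Matrix.one_apply, Matrix.single_apply]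
  fin_cases i <;> fin_cases j <;> first | exact absurd rfl hij | (simp; ring)

/-- Over a field every matrix is a product of transvections and diagonal matrices, for which the
identity is a short polynomial computation; the claim is multiplicative in `g`. -/
theorem aronhold_linearSubst {K : Type*} [Field K] (g : Matrix (Fin 3) (Fin 3) K)
    (a b c a₂ a₃ b₁ b₃ c₁ c₂ m : K) :
    aronhold (linearSubst g (ternaryCubic a b c a₂ a₃ b₁ b₃ c₁ c₂ m)) =
      g.det ^ 4 * aronhold (ternaryCubic a b c a₂ a₃ b₁ b₃ c₁ c₂ m) := by
  induction g using Matrix.diagonal_transvection_induction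
    generalizing a b c a₂ a₃ b₁ b₃ c₁ c₂ m with
  | hdiag d _ => exact aronhold_linearSubst_diagonal d _ _ _ _ _ _ _ _ _ _
  | htransvec t =>
    rw [Matrix.TransvectionStruct.det, one_pow, one_mul]
    exact aronhold_linearSubst_transvection t.hij t.c _ _ _ _ _ _ _ _ _ _
  | hmul A B hA hB =>
    -- The Taylor expansion presents the cubic transformed by `A` through its coefficients, the form
    -- to which the hypothesis for `B` applies.
    rw [← linearSubst_linearSubst, linearSubst_ternaryCubic A rfl rfl rfl rfl, hB,
      ← linearSubst_ternaryCubic A rfl rfl rfl rfl, hA, Matrix.det_mul]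
    ring

end LinearSubstitution

/-! ### Existence of flexes and adapted coordinate frames. -/

/-- Two polynomials in three variables over an algebraically closed field which both vanish at the
origin have another common zero. -/
theorem exists_ne_common_zero {K : Type*} [Field K] [IsAlgClosed K] {F G : MvPolynomial (Fin 3) K}
    (hF : eval 0 F = 0) (hG : eval 0 G = 0) : ∃ p ≠ 0, eval p F = 0 ∧ eval p G = 0 := by
  by_contra! hno
  -- If the origin were the only common zero, translates of `F` and `G` would cut out any given
  -- point, so every maximal ideal would be minimal over two elements, and Krull's height theorem
  -- would contradict dimension 3.
  suffices h : ringKrullDim (MvPolynomial (Fin 3) K) ≤ 2 by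
    rw [MvPolynomial.ringKrullDim_of_isNoetherianRing, ringKrullDim_eq_zero_of_field] at h
    simp only [Nat.card_eq_fintype_card, Fintype.card_fin, zero_add] at h
    exact absurd h (by decide)
  rw [ringKrullDim_le_iff_isMaximal_height_le]
  intro M hM
  obtain ⟨q, rfl⟩ := eq_vanishingIdeal_singleton_of_isMaximal K hM
  let τ : MvPolynomial (Fin 3) K →ₐ[K] MvPolynomial (Fin 3) K := aeval fun i => X i - C (q i)
  have hτ (p : Fin 3 → K) (H : MvPolynomial (Fin 3) K) : aeval p (τ H) = eval (p - q) H := by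
    have : (aeval p : MvPolynomial (Fin 3) K →ₐ[K] K).comp τ = aeval (p - q) := by
      ext1 i
      simp [τ]
    exact DFunLike.congr_fun this H
  have hz : zeroLocus K (Ideal.span {τ F, τ G}) = {q} := by
    ext p
    simp only [zeroLocus_span, Set.mem_insert_iff, Set.mem_singleton_iff, forall_eq_or_imp,
      forall_eq, Set.mem_ofPred_eq, hτ]
    refine ⟨fun ⟨h1, h2⟩ => ?_, ?_⟩
    · by_contra hp
      exact hno (p - q) (sub_ne_zero.2 hp) h1 h2
    · rintro rfl
      rw [sub_self]
      exact ⟨hF, hG⟩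
  have hmin : vanishingIdeal K {q} ∈ (Ideal.span {τ F, τ G}).minimalPrimes := by
    have hrad := vanishingIdeal_zeroLocus_eq_radical (K := K) (Ideal.span {τ F, τ G})
    rw [hz] at hrad
    refine ⟨⟨hM.isPrime, ?_⟩, fun J hJ _ => ?_⟩
    · rw [hrad]
      exact Ideal.le_radical
    · rw [hrad]
      exact (hJ.1.radical_le_iff).2 hJ.2
  have hle := Ideal.height_le_card_of_mem_minimalPrimes_span (Set.toFinite _) hmin
  have hcard := (Set.ncard_insert_le (τ F) {τ G}).trans_eq (by rw [Set.ncard_singleton])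
  exact WithBot.coe_le_coe.2 (hle.trans (Nat.cast_le.2 hcard))

/-- An invertible matrix with prescribed second column `p`, whose first column lies in the kernel
of the linear form `l`. -/
theorem exists_frame {K : Type*} [Field K] {p l : Fin 3 → K} (hp : p ≠ 0) (hl : l ≠ 0)
    (hlp : l 0 * p 0 + l 1 * p 1 + l 2 * p 2 = 0) :
    ∃ g : Matrix (Fin 3) (Fin 3) K, IsUnit g.det ∧ (fun i => g i 1) = p ∧
      l 0 * g 0 0 + l 1 * g 1 0 + l 2 * g 2 0 = 0 ∧
      l 0 * g 0 2 + l 1 * g 1 2 + l 2 * g 2 2 ≠ 0 := by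
  obtain ⟨i, hi⟩ := Function.ne_iff.1 hp
  obtain ⟨j, hj⟩ := Function.ne_iff.1 hl
  let s : Fin 3 → K := Pi.single i 1
  let r : Fin 3 → K := Pi.single j 1
  have hs : s 0 * p 0 + s 1 * p 1 + s 2 * p 2 ≠ 0 := by
    fin_cases i <;> simpa [s] using hi
  have hr : l 0 * r 0 + l 1 * r 1 + l 2 * r 2 ≠ 0 := by
    fin_cases j <;> simpa [r] using hj
  generalize r = r at hr
  generalize s = s at hs
  -- The columns are `l × s`, `p`, `r`. As `l · p = 0`, the determinant is `-(s · p)(l · r)`.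
  refine ⟨!![l 1 * s 2 - l 2 * s 1, p 0, r 0; l 2 * s 0 - l 0 * s 2, p 1, r 1;
    l 0 * s 1 - l 1 * s 0, p 2, r 2], ?_, ?_, ?_, ?_⟩
  · rw [isUnit_iff_ne_zero, Matrix.det_fin_three]
    simp
    intro h
    apply mul_ne_zero hs hr
    linear_combination -h + (s 0 * r 0 + s 1 * r 1 + s 2 * r 2) * hlp
  · ext i
    fin_cases i <;> rfl
  · simp
    ring
  · simpa using hr

/-! ### Smooth cubics: Weierstrass form, discriminant criterion and j-invariant. -/

section SmoothCubics

theorem isSmoothPlaneCurve_linearSubst {F : MvPolynomial (Fin 3) ℂ}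
    (hF : IsSmoothPlaneCurve F) {g : Matrix (Fin 3) (Fin 3) ℂ} (hg : IsUnit g.det) :
    IsSmoothPlaneCurve (linearSubst g F) := by
  intro p hp h0
  rw [eval_linearSubst] at h0
  have hginj : Function.Injective g.mulVec :=
    Matrix.mulVec_injective_iff_isUnit.2 ((Matrix.isUnit_iff_isUnit_det g).2 hg)
  have hgp : g.mulVec p ≠ 0 := fun h => hp (hginj (h.trans (Matrix.mulVec_zero g).symm))
  obtain ⟨i, hi⟩ := hF _ hgp h0
  by_contra! h
  -- By the chain rule, the gradient of the transformed form at `p` is the gradient of `F` at `g p`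
  -- times the invertible matrix `g`.
  have hv : Matrix.vecMul (fun i => eval (g.mulVec p) (pderiv i F)) g = 0 := by
    ext j
    rw [Pi.zero_apply, ← h j, pderiv_linearSubst]
    simp [Matrix.vecMul, dotProduct, eval_linearSubst, mul_comm]
  have hvinj : Function.Injective g.vecMul :=
    Matrix.vecMul_injective_iff_isUnit.2 ((Matrix.isUnit_iff_isUnit_det g).2 hg)
  exact hi (congrFun (hvinj (hv.trans (Matrix.zero_vecMul g).symm)) i)

theorem isSmoothPlaneCurve_of_C_mul {F : MvPolynomial (Fin 3) ℂ} {c : ℂ}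
    (hF : IsSmoothPlaneCurve (C c * F)) : IsSmoothPlaneCurve F := by
  intro p hp h0
  obtain ⟨i, hi⟩ := hF p hp (by simp [h0])
  rw [pderiv_C_mul_eq] at hi
  exact ⟨i, fun h => hi (by simp [h])⟩

theorem exists_invertible_column {p : Fin 3 → ℂ} (hp : p ≠ 0) :
    ∃ g : Matrix (Fin 3) (Fin 3) ℂ, IsUnit g.det ∧ (fun i => g i 2) = p := by
  have h : p 0 ≠ 0 ∨ p 1 ≠ 0 ∨ p 2 ≠ 0 := by
    obtain ⟨i, hi⟩ := Function.ne_iff.1 hp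
    fin_cases i <;> simp_all
  rcases h with h | h | h
  · refine ⟨!![0, 0, p 0; 1, 0, p 1; 0, 1, p 2], by simp [Matrix.det_fin_three, h], ?_⟩
    ext i
    fin_cases i <;> rfl
  · refine ⟨!![1, 0, p 0; 0, 0, p 1; 0, 1, p 2], by simp [Matrix.det_fin_three, h], ?_⟩
    ext i
    fin_cases i <;> rfl
  · refine ⟨!![1, 0, p 0; 0, 1, p 1; 0, 0, p 2], by simp [Matrix.det_fin_three, h], ?_⟩
    ext i
    fin_cases i <;> rfl

theorem isSmoothPlaneCurve_of_cubicDiscriminant_ne_zero {a b c a₂ a₃ b₁ b₃ c₁ c₂ m : ℂ}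
    (h : cubicDiscriminant (ternaryCubic a b c a₂ a₃ b₁ b₃ c₁ c₂ m) ≠ 0) :
    IsSmoothPlaneCurve (ternaryCubic a b c a₂ a₃ b₁ b₃ c₁ c₂ m) := by
  by_contra hs
  simp only [IsSmoothPlaneCurve, not_forall, not_exists, not_not] at hs
  obtain ⟨p, hp, h0, hd⟩ := hs
  obtain ⟨g, hg, hgp⟩ := exists_invertible_column hp
  have hdisc := cubicDiscriminant_linearSubst g a b c a₂ a₃ b₁ b₃ c₁ c₂ m
  rw [linearSubst_ternaryCubic g rfl rfl rfl hgp.symm, h0, cubicDiscriminant_eq] at hdisc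
  have hdir (v : Fin 3 → ℂ) :
      directionalDerivative (ternaryCubic a b c a₂ a₃ b₁ b₃ c₁ c₂ m) p v = 0 := by
    simp [directionalDerivative, hd]
  rw [hdir, hdir, det_discriminantMatrix_of_singular, smul_zero, eq_comm, mul_eq_zero] at hdisc
  exact hdisc.elim (pow_ne_zero _ hg.ne_zero) h

/-- A Weierstrass cubic with vanishing discriminant has a singular point. -/
theorem weierstrass_Δ_ne_zero_of_isSmoothPlaneCurve {W : WeierstrassCurve ℂ}
    (hW : IsSmoothPlaneCurve (WeierstrassCurve.Projective.polynomial W)) : W.Δ ≠ 0 := by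
  intro hΔ
  have ha : W.twoTorsionPolynomial.a ≠ 0 := by
    simp [WeierstrassCurve.twoTorsionPolynomial]
  obtain ⟨x, y, z, h3⟩ := (Cubic.splits_iff_roots_eq_three (φ := RingHom.id ℂ) ha).1
    (IsAlgClosed.splits _)
  have hdisc : ¬ W.twoTorsionPolynomial.discr ≠ 0 := by
    rw [WeierstrassCurve.twoTorsionPolynomial_discr, hΔ, mul_zero, not_not]
  rw [Cubic.discr_ne_zero_iff_roots_ne ha h3] at hdisc
  have hb := Cubic.b_eq_three_roots ha h3
  have hc := Cubic.c_eq_three_roots ha h3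
  have hd := Cubic.d_eq_three_roots ha h3
  simp only [WeierstrassCurve.twoTorsionPolynomial, RingHom.id_apply] at hb hc hd
  -- Here `r` is a repeated root of the 2-torsion polynomial and `s` the remaining root.
  obtain ⟨r, s, hb, hc, hd⟩ : ∃ r s : ℂ, W.b₂ = -4 * (2 * r + s) ∧
      2 * W.b₄ = 4 * (r ^ 2 + 2 * r * s) ∧ W.b₆ = -4 * (r ^ 2 * s) := by
    by_cases hxy : x = y
    · exact ⟨x, z, by rw [hb, hxy]; ring, by rw [hc, hxy]; ring, by rw [hd, hxy]; ring⟩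
    by_cases hxz : x = z
    · exact ⟨x, y, by rw [hb, hxz]; ring, by rw [hc, hxz]; ring, by rw [hd, hxz]; ring⟩
    have hyz : y = z := by tauto
    exact ⟨y, x, by rw [hb, hyz]; ring, by rw [hc, hyz]; ring, by rw [hd, hyz]; ring⟩
  rw [WeierstrassCurve.b₂] at hb
  rw [WeierstrassCurve.b₄] at hc
  rw [WeierstrassCurve.b₆] at hd
  rw [weierstrassPolynomial_eq_ternaryCubic] at hW
  -- The singular point lies over `r`; its second coordinate makes the `y`-derivative vanish.
  obtain ⟨i, hi⟩ := hW ![r, -(W.a₁ * r + W.a₃) / 2, 1]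
    (fun h => one_ne_zero (congrFun h 2)) (by
      rw [eval_ternaryCubic]
      simp
      linear_combination (-1 / 4 : ℂ) * r ^ 2 * hb - r * hc / 4 - hd / 4)
  apply hi
  fin_cases i
  · simp only [Fin.zero_eta, pderiv_zero_ternaryCubic, eval_ternaryQuadric]
    simp
    linear_combination (-1 / 2 : ℂ) * r * hb - hc / 4
  · simp only [Fin.mk_one, pderiv_one_ternaryCubic, eval_ternaryQuadric]
    simp
    ring
  · simp only [Fin.reduceFinMk, pderiv_two_ternaryCubic, eval_ternaryQuadric]
    simp
    linear_combination (-1 / 4 : ℂ) * r ^ 2 * hb - r * hc / 2 - 3 * hd / 4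

theorem C_mul_ternaryCubic {R : Type*} [CommRing R] (r a b c a₂ a₃ b₁ b₃ c₁ c₂ m : R) :
    C r * ternaryCubic a b c a₂ a₃ b₁ b₃ c₁ c₂ m =
      ternaryCubic (r * a) (r * b) (r * c) (r * a₂) (r * a₃) (r * b₁) (r * b₃) (r * c₁) (r * c₂)
        (r * m) := by
  simp only [ternaryCubic, C_mul]
  ring

/-- A cubic with a flex at `(0 : 1 : 0)` with tangent line `z = 0` has a Weierstrass equation. -/
theorem exists_linearSubst_eq_weierstrassPolynomial {a c a₃ b₃ c₁ c₂ m : ℂ} (ha : a ≠ 0)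
    (hb : b₃ ≠ 0) : ∃ (W : WeierstrassCurve ℂ) (g : Matrix (Fin 3) (Fin 3) ℂ), IsUnit g.det ∧
      linearSubst g (ternaryCubic a 0 c 0 a₃ 0 b₃ c₁ c₂ m) =
        C (-a) * WeierstrassCurve.Projective.polynomial W := by
  -- Scaling `z` by `-a / b₃` makes the coefficients of `x³` and `y²z` opposite; dividing by `-a`
  -- then gives the Weierstrass coefficients.
  refine ⟨⟨m / b₃, -a₃ / b₃, -c₂ * a / b₃ ^ 2, c₁ * a / b₃ ^ 2, -c * a ^ 2 / b₃ ^ 3⟩,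
    Matrix.diagonal ![1, 1, -a / b₃], ?_, ?_⟩
  · simp [Fin.prod_univ_three, ha, hb]
  · rw [weierstrassPolynomial_eq_ternaryCubic, linearSubst_ternaryCubic _ rfl rfl rfl rfl]
    rw [C_mul_ternaryCubic]
    simp only [directionalDerivative, Fin.sum_univ_three, pderiv_zero_ternaryCubic,
      pderiv_one_ternaryCubic, pderiv_two_ternaryCubic, eval_ternaryCubic, eval_ternaryQuadric,
      pderiv_zero_ternaryQuadric, pderiv_one_ternaryQuadric, pderiv_two_ternaryQuadric,
      map_add, map_mul, eval_C, eval_X, map_ofNat]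
    congr 1 <;> simp <;> field_simp

theorem exists_projectivelyEquivalent_weierstrassPolynomial {a b c a₂ a₃ b₁ b₃ c₁ c₂ m : ℂ}
    (hF : IsSmoothPlaneCurve (ternaryCubic a b c a₂ a₃ b₁ b₃ c₁ c₂ m)) :
    ∃ W : WeierstrassCurve ℂ, ProjectivelyEquivalent (ternaryCubic a b c a₂ a₃ b₁ b₃ c₁ c₂ m)
      (WeierstrassCurve.Projective.polynomial W) := by
  have hH := hessianDet_ternaryCubic a b c a₂ a₃ b₁ b₃ c₁ c₂ m
  generalize hFdef : ternaryCubic a b c a₂ a₃ b₁ b₃ c₁ c₂ m = F at *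
  obtain ⟨p, hp, hp0, hpH⟩ := exists_ne_common_zero (F := F) (G := hessianDet F)
    (by rw [← hFdef, eval_ternaryCubic]; simp) (by rw [hH, eval_ternaryCubic]; simp)
  obtain ⟨i, hi⟩ := hF p hp hp0
  -- New coordinates put the flex `p` at `(0 : 1 : 0)` with tangent line `z = 0`. Euler's identity
  -- shows that `p` lies on its tangent line.
  obtain ⟨g, hg, hgp, hg0, hg2⟩ := exists_frame (l := fun i => eval p (pderiv i F)) hp
    (fun h => hi (congrFun h i)) (by
      rw [← hFdef, eval_ternaryCubic] at hp0
      simp only [← hFdef, pderiv_zero_ternaryCubic, pderiv_one_ternaryCubic,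
        pderiv_two_ternaryCubic, eval_ternaryQuadric]
      linear_combination 3 * hp0)
  have hsm := isSmoothPlaneCurve_linearSubst hF hg
  have hT := linearSubst_ternaryCubic g hFdef.symm rfl hgp.symm rfl
  have hHT := congrArg (eval ![0, 1, 0]) (hessianDet_linearSubst g F)
  have hgp' : g.mulVec ![0, 1, 0] = p := by
    rw [← hgp]
    ext i
    simp [Matrix.mulVec, dotProduct, Fin.sum_univ_three]
  rw [map_mul, eval_linearSubst, hgp', hpH, mul_zero, hT, hessianDet_ternaryCubic,
    eval_ternaryCubic] at hHT
  have hb₁ : directionalDerivative F p (fun i => g i 0) = 0 := by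
    rw [directionalDerivative, Fin.sum_univ_three]
    linear_combination hg0
  have hb₃ : directionalDerivative F p (fun i => g i 2) ≠ 0 := by
    rw [directionalDerivative, Fin.sum_univ_three]
    intro h
    exact hg2 (by linear_combination h)
  rw [hp0, hb₁] at hT hHT
  generalize directionalDerivative F p (fun i => g i 2) = b₃' at *
  generalize directionalDerivative F (fun i => g i 0) p = a₂' at *
  -- Once the coefficients of `y³` and `xy²` vanish, the value of the Hessian at the flex is `-8 a₂'
  -- b₃'²`.
  obtain rfl : a₂' = 0 := by
    simpa [hb₃] using hHT
  generalize eval (fun i => g i 0) F = a' at *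
  generalize eval (fun i => g i 2) F = c' at *
  generalize directionalDerivative F (fun i => g i 0) (fun i => g i 2) = a₃' at *
  generalize directionalDerivative F (fun i => g i 2) (fun i => g i 0) = c₁' at *
  generalize directionalDerivative F (fun i => g i 2) p = c₂' at *
  generalize (∑ i, p i * directionalDerivative (pderiv i F) (fun i => g i 0) (fun i => g i 2)) =
    m' at *
  -- Otherwise the line `z = 0` is a component of the cubic. The `z`-derivative restricts to it as
  -- `a₃'x² + m'xy + b₃'y²`, and a root of this quadratic is a singular point.
  have ha : a' ≠ 0 := by
    rintro rfl
    obtain ⟨y, hy⟩ := exists_quadratic_eq_zero (b := m') (c := a₃') hb₃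
      (IsAlgClosed.exists_eq_mul_self _)
    rw [hT] at hsm
    obtain ⟨i, hi⟩ := hsm ![1, y, 0] (fun h => one_ne_zero (congrFun h 0)) (by
      rw [eval_ternaryCubic]
      simp)
    apply hi
    fin_cases i
    · simp [pderiv_zero_ternaryCubic, eval_ternaryQuadric]
    · simp [pderiv_one_ternaryCubic, eval_ternaryQuadric]
    · simp only [Fin.reduceFinMk, pderiv_two_ternaryCubic, eval_ternaryQuadric]
      simp
      linear_combination hy
  obtain ⟨W, h, hh, hW⟩ := exists_linearSubst_eq_weierstrassPolynomial (c := c') (a₃ := a₃')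
    (c₁ := c₁') (c₂ := c₂') (m := m') ha hb₃
  refine ⟨W, g * h, -a', by rw [Matrix.det_mul]; exact hg.mul hh, neg_ne_zero.2 ha, ?_⟩
  rw [← hW, ← hT, linearSubst_linearSubst]
  rfl

/-- One scalar, `t = det g / r`, governs both invariants, because they have degrees 4 and 12 in the
coefficients and the same weights 4 and 12 in `det g`. It cancels in `c₄³/Δ`. -/
theorem invariants_of_projectivelyEquivalent {W : WeierstrassCurve ℂ}
    {a b c a₂ a₃ b₁ b₃ c₁ c₂ m : ℂ}
    (h : ProjectivelyEquivalent (ternaryCubic a b c a₂ a₃ b₁ b₃ c₁ c₂ m)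
      (WeierstrassCurve.Projective.polynomial W)) :
    ∃ t : ℂ, t ≠ 0 ∧ W.c₄ = t ^ 4 * aronhold (ternaryCubic a b c a₂ a₃ b₁ b₃ c₁ c₂ m) ∧
      W.Δ = t ^ 12 * cubicDiscriminant (ternaryCubic a b c a₂ a₃ b₁ b₃ c₁ c₂ m) := by
  obtain ⟨g, r, hg, hr, h⟩ := h
  change linearSubst g _ = _ at h
  refine ⟨g.det / r, div_ne_zero hg.ne_zero hr, ?_, ?_⟩
  · have := congrArg aronhold h
    rw [aronhold_linearSubst, aronhold_C_mul, aronhold_weierstrassPolynomial] at this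
    rw [div_pow, div_mul_eq_mul_div, this]
    field_simp
  · have := congrArg cubicDiscriminant h
    rw [cubicDiscriminant_linearSubst, cubicDiscriminant_C_mul,
      cubicDiscriminant_weierstrassPolynomial] at this
    rw [div_pow, div_mul_eq_mul_div, this]
    field_simp

/-- A plane cubic is smooth if and only if its discriminant is nonzero. -/
theorem isSmoothPlaneCurve_ternaryCubic_iff {a b c a₂ a₃ b₁ b₃ c₁ c₂ m : ℂ} :
    IsSmoothPlaneCurve (ternaryCubic a b c a₂ a₃ b₁ b₃ c₁ c₂ m) ↔
      cubicDiscriminant (ternaryCubic a b c a₂ a₃ b₁ b₃ c₁ c₂ m) ≠ 0 := by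
  refine ⟨fun hF h0 => ?_, isSmoothPlaneCurve_of_cubicDiscriminant_ne_zero⟩
  obtain ⟨W, hW⟩ := exists_projectivelyEquivalent_weierstrassPolynomial hF
  obtain ⟨t, -, -, hΔ⟩ := invariants_of_projectivelyEquivalent hW
  obtain ⟨g, r, hg, hr, h⟩ := hW
  have hsm := isSmoothPlaneCurve_linearSubst hF hg
  rw [linearSubst, h] at hsm
  exact weierstrass_Δ_ne_zero_of_isSmoothPlaneCurve (isSmoothPlaneCurve_of_C_mul hsm)
    (by rw [hΔ, h0, mul_zero])

/-- The j-invariant of a smooth plane cubic. -/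
theorem isJInvariant_ternaryCubic_iff {a b c a₂ a₃ b₁ b₃ c₁ c₂ m : ℂ}
    (hF : IsSmoothPlaneCurve (ternaryCubic a b c a₂ a₃ b₁ b₃ c₁ c₂ m)) (j : ℂ) :
    IsJInvariant (ternaryCubic a b c a₂ a₃ b₁ b₃ c₁ c₂ m) j ↔
      j = aronhold (ternaryCubic a b c a₂ a₃ b₁ b₃ c₁ c₂ m) ^ 3 /
        cubicDiscriminant (ternaryCubic a b c a₂ a₃ b₁ b₃ c₁ c₂ m) := by
  have hD := isSmoothPlaneCurve_ternaryCubic_iff.1 hF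
  have hj {W : WeierstrassCurve ℂ} [W.IsElliptic]
      (hW : ProjectivelyEquivalent (ternaryCubic a b c a₂ a₃ b₁ b₃ c₁ c₂ m)
        (WeierstrassCurve.Projective.polynomial W)) :
      W.j = aronhold (ternaryCubic a b c a₂ a₃ b₁ b₃ c₁ c₂ m) ^ 3 /
        cubicDiscriminant (ternaryCubic a b c a₂ a₃ b₁ b₃ c₁ c₂ m) := by
    obtain ⟨t, ht, hc, hΔ⟩ := invariants_of_projectivelyEquivalent hW
    rw [WeierstrassCurve.j, Units.val_inv_eq_inv_val, WeierstrassCurve.coe_Δ', hc, hΔ]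
    field_simp
  constructor
  · rintro ⟨W, _, hW, rfl⟩
    exact hj hW
  · rintro rfl
    obtain ⟨W, hW⟩ := exists_projectivelyEquivalent_weierstrassPolynomial hF
    obtain ⟨t, ht, -, hΔ⟩ := invariants_of_projectivelyEquivalent hW
    have hell : W.IsElliptic :=
      ⟨isUnit_iff_ne_zero.2 (by rw [hΔ]; exact mul_ne_zero (pow_ne_zero _ ht) hD)⟩
    exact ⟨W, hell, hW, hj hW⟩

end SmoothCubics

/-! ### Irreducibility through Eisenstein's criterion and specialization. -/

section Irreducibility

/-- Eisenstein's criterion for bivariate polynomials over a field, at the prime `T`. -/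
theorem irreducible_bivariate_eisenstein {K : Type*} [Field K] {n : ℕ} (hn : n ≠ 0) {a : K}
    (ha : a ≠ 0) (q : ℕ → Polynomial K) (hq : (q 0).coeff 0 ≠ 0) :
    Irreducible (Polynomial.C (Polynomial.C a) * Polynomial.X ^ n +
      ∑ i ∈ Finset.range n, Polynomial.C (Polynomial.X * q i) * Polynomial.X ^ i) ∧
    (Polynomial.C (Polynomial.C a) * Polynomial.X ^ n +
      ∑ i ∈ Finset.range n, Polynomial.C (Polynomial.X * q i) * Polynomial.X ^ i).natDegree =
      n := by
  set f := Polynomial.C (Polynomial.C a) * Polynomial.X ^ n +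
      ∑ i ∈ Finset.range n, Polynomial.C (Polynomial.X * q i) * Polynomial.X ^ i with hf
  have hlt : (∑ i ∈ Finset.range n,
      Polynomial.C (Polynomial.X * q i) * Polynomial.X ^ i).degree < (n : WithBot ℕ) := by
    refine (Polynomial.degree_sum_le _ _).trans_lt ((Finset.sup_lt_iff (WithBot.bot_lt_coe n)).2 ?_)
    intro i hi
    exact (Polynomial.degree_C_mul_X_pow_le _ _).trans_lt
      (WithBot.coe_lt_coe.2 (Finset.mem_range.1 hi))
  have hCa : Polynomial.C a ≠ 0 := Polynomial.C_ne_zero.2 ha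
  have hdeg : f.degree = (n : WithBot ℕ) := by
    rw [hf, Polynomial.degree_add_eq_left_of_degree_lt, Polynomial.degree_C_mul_X_pow n hCa]
    rwa [Polynomial.degree_C_mul_X_pow n hCa]
  have hlead : f.leadingCoeff = Polynomial.C a := by
    rw [hf, add_comm, Polynomial.leadingCoeff_add_of_degree_lt, Polynomial.leadingCoeff_C_mul_X_pow]
    rwa [Polynomial.degree_C_mul_X_pow n hCa]
  have hcoeff (i : ℕ) (hi : i < n) : f.coeff i = Polynomial.X * q i := by
    rw [hf, Polynomial.coeff_add, Polynomial.coeff_C_mul_X_pow, if_neg hi.ne, zero_add,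
      Polynomial.finsetSum_coeff, Finset.sum_eq_single i]
    · rw [Polynomial.coeff_C_mul_X_pow, if_pos rfl]
    · intro j _ hj
      rw [Polynomial.coeff_C_mul_X_pow, if_neg hj.symm]
    · intro h
      exact absurd (Finset.mem_range.2 hi) h
  have hunit : IsUnit (Polynomial.C a) := Polynomial.isUnit_C.2 ha.isUnit
  have hprime : (Ideal.span {(Polynomial.X : Polynomial K)}).IsPrime :=
    (Ideal.span_singleton_prime Polynomial.X_ne_zero).2 Polynomial.prime_X
  refine ⟨?_, Polynomial.natDegree_eq_of_degree_eq_some hdeg⟩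
  refine Polynomial.irreducible_of_eisenstein_criterion hprime ?_ ?_ ?_ ?_ ?_
  · rw [hlead]
    exact fun h => hprime.ne_top (Ideal.eq_top_of_isUnit_mem _ h hunit)
  · intro i hi
    rw [hdeg, Nat.cast_lt] at hi
    rw [hcoeff i hi]
    exact Ideal.mul_mem_right _ _ (Ideal.mem_span_singleton_self _)
  · rw [hdeg]
    exact Nat.cast_pos.2 (Nat.pos_of_ne_zero hn)
  · rw [hcoeff 0 (Nat.pos_of_ne_zero hn), Ideal.span_singleton_pow, Ideal.mem_span_singleton, sq]
    intro h
    have h2 := (mul_dvd_mul_iff_left Polynomial.X_ne_zero).1 h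
    exact hq (Polynomial.X_dvd_iff.1 h2)
  · intro r hr
    refine isUnit_of_dvd_unit ?_ hunit
    rw [← hlead]
    exact (Polynomial.C_dvd_iff_dvd_coeff r f).1 hr _

/-- A polynomial is irreducible if it stays irreducible, of the same degree, after a substitution
of polynomials that are linear in a distinguished variable. -/
theorem irreducible_of_irreducible_aeval {σ K A : Type*} [Field K] [CommRing A] [IsDomain A]
    [Algebra K A] {P : MvPolynomial σ K} (v : σ → Polynomial A) (hv : ∀ i, (v i).natDegree ≤ 1)
    (hdeg : P.totalDegree ≤ (aeval v P).natDegree) (hirr : Irreducible (aeval v P)) :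
    Irreducible P := by
  have hle (Q : MvPolynomial σ K) : (aeval v Q).natDegree ≤ Q.totalDegree := by
    have h := MvPolynomial.aeval_natDegree_le (m := Q.totalDegree) (n := 1)
      (map (algebraMap K A) Q) (by
        refine Finset.sup_mono ?_
        exact support_map_subset _ _) v hv
    rwa [aeval_map_algebraMap, mul_one] at h
  have hP : P ≠ 0 := by
    rintro rfl
    exact hirr.ne_zero (map_zero _)
  -- If `g` maps to a unit, the image of `h` alone must carry the full degree of `P`. Degrees do not
  -- grow under `v`, so `g` is a nonzero constant.
  have key {g h : MvPolynomial σ K} (hgh : P = g * h) (hg : IsUnit (aeval v g)) : IsUnit g := by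
    have hgh0 : g * h ≠ 0 := hgh ▸ hP
    rw [hgh, map_mul, totalDegree_mul_of_isDomain (left_ne_zero_of_mul hgh0)
      (right_ne_zero_of_mul hgh0)] at hdeg
    have h1 := hdeg.trans Polynomial.natDegree_mul_le
    rw [Polynomial.natDegree_eq_zero_of_isUnit hg, zero_add] at h1
    have h2 := h1.trans (hle h)
    have h3 : g.totalDegree = 0 := by omega
    rw [totalDegree_eq_zero_iff_eq_C] at h3
    have h0 : g.coeff 0 ≠ 0 := by
      intro h0
      rw [h0, C_0] at h3
      exact left_ne_zero_of_mul hgh0 h3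
    rw [h3]
    exact h0.isUnit.map C
  refine ⟨fun h => hirr.not_isUnit (h.map (aeval v)), fun g h hgh => ?_⟩
  rcases hirr.isUnit_or_isUnit ((congrArg (aeval v) hgh).trans (map_mul _ g h)) with hu | hu
  · exact Or.inl (key hgh hu)
  · exact Or.inr (key (hgh.trans (mul_comm g h)) hu)

end Irreducibility

/-! ### The pencil `X² + cΛ`. -/

section SpohnForms

theorem map_spohnQuartic {R S : Type*} [CommRing R] [CommRing S] (f : R →+* S)
    (a b : Matrix (Fin 2) (Fin 2) R) :
    f (spohnQuartic a b) = spohnQuartic (a.map f) (b.map f) := by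
  simp [spohnQuartic, map_ofNat f]

theorem map_differenceProduct {R S : Type*} [CommRing R] [CommRing S] (f : R →+* S)
    (a b : Matrix (Fin 2) (Fin 2) R) :
    f (differenceProduct a b) = differenceProduct (a.map f) (b.map f) := by
  simp [differenceProduct]

/-- The pencil of forms spanned by `X²` and `Λ`, where `X` is `spohnQuartic` and `Λ` is
`differenceProduct`. -/
noncomputable def spohnPencil (c : ℂ) : MvPolynomial PayoffVar ℂ :=
  spohnQuartic genericA genericB ^ 2 + C c * differenceProduct genericA genericB

theorem isHomogeneous_spohnPencil (c : ℂ) : (spohnPencil c).IsHomogeneous 8 := by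
  have hA (i j i' j' : Fin 2) : (genericA i j - genericA i' j').IsHomogeneous 1 :=
    (isHomogeneous_X _ _).sub (isHomogeneous_X _ _)
  have hB (i j i' j' : Fin 2) : (genericB i j - genericB i' j').IsHomogeneous 1 :=
    (isHomogeneous_X _ _).sub (isHomogeneous_X _ _)
  have hAB {i j i' j' k l k' l' : Fin 2} :
      ((genericA i j - genericA i' j') * (genericB k l - genericB k' l')).IsHomogeneous 2 :=
    (hA _ _ _ _).mul (hB _ _ _ _)
  have hAABB {i j i' j' k l k' l' p q p' q' r s r' s' : Fin 2} :
      ((genericA i j - genericA i' j') * (genericA k l - genericA k' l') *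
        ((genericB p q - genericB p' q') * (genericB r s - genericB r' s'))).IsHomogeneous 4 :=
    ((hA _ _ _ _).mul (hA _ _ _ _)).mul ((hB _ _ _ _).mul (hB _ _ _ _))
  have hC {n : ℕ} {P : MvPolynomial PayoffVar ℂ} (r : ℂ) (h : P.IsHomogeneous n) :
      (C r * P).IsHomogeneous n := by
    simpa using (isHomogeneous_C _ r).mul h
  have h4 : (4 : MvPolynomial PayoffVar ℂ) = C 4 := (map_ofNat C 4).symm
  have h2 : (2 : MvPolynomial PayoffVar ℂ) = C 2 := (map_ofNat C 2).symm
  have hQ : (spohnQuartic genericA genericB).IsHomogeneous 4 := by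
    rw [spohnQuartic, h4, h2]
    exact ((hAB.add hAB).pow 2).sub (hC _ ((hAABB.add hAABB).sub (hC _ hAABB)))
  refine (hQ.pow 2).add (hC _ ?_)
  exact ((((hA _ _ _ _).mul (hA _ _ _ _)).mul (hB _ _ _ _)).mul (hB _ _ _ _)).mul
    ((((hA _ _ _ _).mul (hA _ _ _ _)).mul (hB _ _ _ _)).mul (hB _ _ _ _))

theorem irreducible_spohnPencil {c : ℂ} (hc : c ≠ 0) : Irreducible (spohnPencil c) := by
  let s : Polynomial (Polynomial ℂ) := Polynomial.X
  let t : Polynomial (Polynomial ℂ) := Polynomial.C Polynomial.X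
  -- The entries are chosen so that at `t = 0` the product `Λ` vanishes (as `a₁₁ = a₂₁`) and `X`
  -- becomes `4s⁴`. The pencil then reduces to `16s⁸` modulo `t`, as Eisenstein's criterion at `t`
  -- requires.
  let A : Matrix (Fin 2) (Fin 2) (Polynomial (Polynomial ℂ)) := !![1, 4 - 2 * s; 1 + t, 0]
  let B : Matrix (Fin 2) (Fin 2) (Polynomial (Polynomial ℂ)) := !![-4 - s, 2 - 2 * s; 2 + s, 0]
  let v : PayoffVar → Polynomial (Polynomial ℂ) :=
    Sum.elim (fun p => A p.1 p.2) (fun p => B p.1 p.2)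
  let x : Polynomial ℂ := Polynomial.X
  let k : Polynomial ℂ := Polynomial.C c
  -- The coefficients of `s⁰, …, s⁷`, divided by `t`. The constant term of `q 0` is `-1728c`; this
  -- is where `c ≠ 0` enters.
  let q : ℕ → Polynomial ℂ := fun i =>
    ([-1728 * k + (186624 - 1728 * k) * x - 13824 * x ^ 2 + 256 * x ^ 3,
      2592 * k + (2592 * k - 228096) * x + 1536 * x ^ 2 + 256 * x ^ 3,
      -144 * k + (14400 - 144 * k) * x + 5408 * x ^ 2 + 96 * x ^ 3,
      -1000 * k + (64896 - 1000 * k) * x + 400 * x ^ 2 + 16 * x ^ 3,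
      (208 * k - 3456) + (208 * k - 14784) * x - 448 * x ^ 2 + x ^ 3,
      (88 * k + 2112) + (88 * k - 4544) * x - 72 * x ^ 2,
      (512 - 16 * k) + (1304 - 16 * k) * x, -288]).getD i 0
  let φ : MvPolynomial PayoffVar ℂ →+* Polynomial (Polynomial ℂ) := (aeval v).toRingHom
  have hA : genericA.map (aeval v) = A := by
    ext1 i j
    simp [genericA, v]
  have hB : genericB.map (aeval v) = B := by
    ext1 i j
    simp [genericB, v]
  have heval : aeval v (spohnPencil c) =
      Polynomial.C (Polynomial.C (16 : ℂ)) * Polynomial.X ^ 8 +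
        ∑ i ∈ Finset.range 8, Polynomial.C (Polynomial.X * q i) * Polynomial.X ^ i := by
    rw [spohnPencil, map_add, map_mul, map_pow, aeval_C]
    have h1 : aeval v (spohnQuartic genericA genericB) = spohnQuartic A B := by
      rw [← hA, ← hB]
      exact map_spohnQuartic φ _ _
    have h2 : aeval v (differenceProduct genericA genericB) = differenceProduct A B := by
      rw [← hA, ← hB]
      exact map_differenceProduct φ _ _
    rw [h1, h2, show algebraMap ℂ (Polynomial (Polynomial ℂ)) c =
      Polynomial.C (Polynomial.C c) from rfl]
    simp only [Finset.sum_range_succ, Finset.sum_range_zero, q, List.getD_cons_zero,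
      List.getD_cons_succ, map_add, map_sub, map_mul, map_pow, map_ofNat, map_neg, x, k]
    simp [spohnQuartic, differenceProduct, A, B, s, t]
    ring
  have hq : (q 0).coeff 0 ≠ 0 := by
    simpa [q, x, k] using hc
  obtain ⟨hirr, hdeg⟩ := irreducible_bivariate_eisenstein (n := 8) (by norm_num)
    (by norm_num : (16 : ℂ) ≠ 0) q hq
  rw [← heval] at hirr hdeg
  refine irreducible_of_irreducible_aeval v ?_ ?_ hirr
  · rintro (⟨i, j⟩ | ⟨i, j⟩) <;> fin_cases i <;> fin_cases j <;> simp [v, A, B, s, t] <;>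
      compute_degree
  · rw [hdeg]
    exact (isHomogeneous_spohnPencil c).totalDegree_le

end SpohnForms

/-! ### Certified arithmetic with sparse univariate polynomials. -/

section SparsePolynomials

/-- The sum of two sparse polynomials, given as lists of exponents and coefficients. If the two
lists are sorted by exponent, then so is the result, provided that the first argument is at least
the number of their entries. -/
def sparseAdd : ℕ → List (ℕ × ℤ) → List (ℕ × ℤ) → List (ℕ × ℤ)
  | 0, l, l' => l ++ l'
  | _ + 1, [], l' => l'
  | _ + 1, t :: l, [] => t :: l
  | n + 1, (k, c) :: l, (k', c') :: l' =>
    bif Nat.blt k k' then (k, c) :: sparseAdd n l ((k', c') :: l')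
    else bif Nat.blt k' k then (k', c') :: sparseAdd n ((k, c) :: l) l'
    else (k, c + c') :: sparseAdd n l l'

/-- The product of a sparse polynomial and a monomial. -/
def sparseScale (k : ℕ) (c : ℤ) (l : List (ℕ × ℤ)) : List (ℕ × ℤ) :=
  l.map fun t => (k + t.1, c * t.2)

/-- The product of two sparse polynomials. -/
def sparseMul (l l' : List (ℕ × ℤ)) : List (ℕ × ℤ) :=
  l.foldr (fun t acc => sparseAdd 2000 (sparseScale t.1 t.2 l') acc) []

/-- The difference of two sparse polynomials. -/
def sparseSub (l l' : List (ℕ × ℤ)) : List (ℕ × ℤ) :=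
  sparseAdd 2000 l (sparseScale 0 (-1) l')

/-- Whether the entries of a sparse polynomial have strictly increasing exponents, all at least
`n`. -/
def sparseSorted : ℕ → List (ℕ × ℤ) → Bool
  | _, [] => true
  | n, t :: l => Nat.ble n t.1 && sparseSorted (t.1 + 1) l

/-- The number of nonzero entries of a sparse polynomial. -/
def sparseCount : List (ℕ × ℤ) → ℕ
  | [] => 0
  | t :: l => bif t.2 == 0 then sparseCount l else sparseCount l + 1

/-- The univariate polynomial over `R` represented by a sparse polynomial. -/
noncomputable def sparseToPolynomial (R : Type*) [CommRing R] (l : List (ℕ × ℤ)) : Polynomial R :=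
  (l.map fun t => Polynomial.monomial t.1 (t.2 : R)).sum

variable {R : Type*} [CommRing R]

theorem sparseToPolynomial_nil : sparseToPolynomial R [] = 0 := rfl

theorem sparseToPolynomial_cons (t : ℕ × ℤ) (l : List (ℕ × ℤ)) :
    sparseToPolynomial R (t :: l) =
      Polynomial.monomial t.1 (t.2 : R) + sparseToPolynomial R l := by
  simp [sparseToPolynomial]

theorem sparseToPolynomial_append (l l' : List (ℕ × ℤ)) :
    sparseToPolynomial R (l ++ l') = sparseToPolynomial R l + sparseToPolynomial R l' := by
  simp [sparseToPolynomial]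

/-- Valid for every bound `n`, since the fallback is concatenation. Too small a bound could only
spoil the sorting, which is checked on the final list. -/
theorem sparseToPolynomial_add (n : ℕ) (l l' : List (ℕ × ℤ)) :
    sparseToPolynomial R (sparseAdd n l l') =
      sparseToPolynomial R l + sparseToPolynomial R l' := by
  induction n generalizing l l' with
  | zero => exact sparseToPolynomial_append l l'
  | succ n ih =>
    match l, l' with
    | [], l' => simp [sparseAdd, sparseToPolynomial_nil]
    | t :: l, [] => simp [sparseAdd, sparseToPolynomial_nil]
    | (k, c) :: l, (k', c') :: l' =>
      rw [sparseAdd]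
      rcases h : Nat.blt k k' with _ | _
      · rcases h' : Nat.blt k' k with _ | _
        · have hk : k = k' := by
            simp only [Nat.blt_eq, ← Bool.not_eq_true] at h h'
            omega
          simp only [cond_false, sparseToPolynomial_cons, ih, hk, Int.cast_add, map_add]
          abel
        · simp only [cond_false, cond_true, sparseToPolynomial_cons, ih]
          abel
      · simp only [cond_true, sparseToPolynomial_cons, ih]
        abel

theorem sparseToPolynomial_scale (k : ℕ) (c : ℤ) (l : List (ℕ × ℤ)) :
    sparseToPolynomial R (sparseScale k c l) =
      Polynomial.monomial k (c : R) * sparseToPolynomial R l := by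
  induction l with
  | nil => simp [sparseScale, sparseToPolynomial_nil]
  | cons t l ih =>
    rw [sparseScale] at ih ⊢
    rw [List.map_cons, sparseToPolynomial_cons, sparseToPolynomial_cons, ih, mul_add,
      Polynomial.monomial_mul_monomial, Int.cast_mul]

theorem sparseToPolynomial_mul (l l' : List (ℕ × ℤ)) :
    sparseToPolynomial R (sparseMul l l') = sparseToPolynomial R l * sparseToPolynomial R l' := by
  induction l with
  | nil => simp [sparseMul, sparseToPolynomial_nil]
  | cons t l ih =>
    rw [sparseMul] at ih ⊢
    rw [List.foldr_cons, sparseToPolynomial_add, sparseToPolynomial_scale, ih,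
      sparseToPolynomial_cons, add_mul]

theorem sparseToPolynomial_sub (l l' : List (ℕ × ℤ)) :
    sparseToPolynomial R (sparseSub l l') = sparseToPolynomial R l - sparseToPolynomial R l' := by
  rw [sparseSub, sparseToPolynomial_add, sparseToPolynomial_scale]
  simp [sub_eq_add_neg]

theorem coeff_sparseToPolynomial_of_lt {n : ℕ} {l : List (ℕ × ℤ)} (h : sparseSorted n l = true)
    {k : ℕ} (hk : k < n) : (sparseToPolynomial R l).coeff k = 0 := by
  induction l generalizing n with
  | nil => simp [sparseToPolynomial_nil]
  | cons t l ih =>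
    rw [sparseSorted, Bool.and_eq_true, Nat.ble_eq] at h
    rw [sparseToPolynomial_cons, Polynomial.coeff_add, ih h.2 (by omega),
      Polynomial.coeff_monomial, if_neg (by omega), add_zero]

/-- Strictly increasing exponents rule out cancellation between entries, and in characteristic zero
a nonzero integer coefficient stays nonzero. -/
theorem card_support_sparseToPolynomial [CharZero R] {n : ℕ} {l : List (ℕ × ℤ)}
    (h : sparseSorted n l = true) :
    (sparseToPolynomial R l).support.card = sparseCount l := by
  induction l generalizing n with
  | nil => simp [sparseToPolynomial_nil, sparseCount]
  | cons t l ih =>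
    rw [sparseSorted, Bool.and_eq_true] at h
    have h0 := coeff_sparseToPolynomial_of_lt (R := R) h.2 (Nat.lt_succ_self t.1)
    rw [sparseToPolynomial_cons, sparseCount]
    by_cases ht : t.2 = 0
    · simp [ht, ih h.2]
    · have hs : (Polynomial.monomial t.1 (t.2 : R) + sparseToPolynomial R l).support =
          insert t.1 (sparseToPolynomial R l).support := by
        ext k
        rw [Polynomial.mem_support_iff, Polynomial.coeff_add, Polynomial.coeff_monomial,
          Finset.mem_insert, Polynomial.mem_support_iff]
        by_cases hk : t.1 = k
        · subst hk
          simp [h0, ht]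
        · simp [hk, Ne.symm hk]
      rw [hs, Finset.card_insert_of_notMem (by simpa using h0), ih h.2, beq_false_of_ne ht]
      rfl

end SparsePolynomials

/-! ### Counting terms by Kronecker substitution. -/

section SpohnSparse

/-- The sparse polynomial `T ^ (16 ^ i)`. -/
def sparseVar (i : ℕ) : List (ℕ × ℤ) := [(16 ^ i, 1)]

/-- The difference `T ^ (16 ^ i) - T ^ (16 ^ j)`. -/
def sparseDiff (i j : ℕ) : List (ℕ × ℤ) := sparseSub (sparseVar i) (sparseVar j)

/-- The Kronecker substitution in `differenceProduct`. -/
def sparseProduct : List (ℕ × ℤ) :=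
  sparseMul (sparseMul (sparseMul (sparseDiff 0 2) (sparseDiff 1 3))
      (sparseMul (sparseDiff 0 1) (sparseDiff 3 2)))
    (sparseMul (sparseMul (sparseDiff 4 5) (sparseDiff 7 6))
      (sparseMul (sparseDiff 4 6) (sparseDiff 7 5)))

/-- The Kronecker substitution in `spohnQuartic`. -/
def sparseQuartic : List (ℕ × ℤ) :=
  let m := sparseAdd 2000 (sparseMul (sparseDiff 1 2) (sparseDiff 7 4))
    (sparseMul (sparseDiff 0 3) (sparseDiff 6 5))
  let α := sparseMul (sparseDiff 0 3) (sparseDiff 1 2)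
  let β := sparseMul (sparseDiff 0 2) (sparseDiff 1 3)
  let γ := sparseMul (sparseDiff 4 5) (sparseDiff 7 6)
  let δ := sparseMul (sparseDiff 7 4) (sparseDiff 6 5)
  sparseSub (sparseMul m m) (sparseScale 0 4 (sparseSub
    (sparseAdd 2000 (sparseMul α γ) (sparseMul β δ)) (sparseScale 0 2 (sparseMul β γ))))

/-- The Kronecker substitution in `spohnPencil`. -/
def sparsePencil (c : ℤ) : List (ℕ × ℤ) :=
  sparseAdd 2000 (sparseMul sparseQuartic sparseQuartic) (sparseScale 0 c sparseProduct)

theorem sparseCount_sparsePencil :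
    (sparseSorted 0 (sparsePencil 48) && sparseSorted 0 (sparsePencil 64) &&
      (sparseCount (sparsePencil 48) == 633) && (sparseCount (sparsePencil 64) == 587)) = true := by
  decide +kernel

/-- The position of an unknown in the Kronecker substitution. -/
def payoffIndex : PayoffVar → ℕ := Sum.elim (fun p => 2 * p.1 + p.2) (fun p => 4 + 2 * p.1 + p.2)

/-- The Kronecker substitution. -/
noncomputable def kronecker : MvPolynomial PayoffVar ℂ →+* Polynomial ℂ :=
  (aeval fun i => Polynomial.X ^ 16 ^ payoffIndex i : MvPolynomial PayoffVar ℂ →ₐ[ℂ] _).toRingHom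

/-- The exponent of the image of a monomial under the Kronecker substitution. -/
def kroneckerExponent (d : PayoffVar →₀ ℕ) : ℕ := ∑ i, 16 ^ payoffIndex i * d i

theorem kronecker_eq_sum (P : MvPolynomial PayoffVar ℂ) :
    kronecker P = ∑ d ∈ P.support, Polynomial.monomial (kroneckerExponent d) (P.coeff d) := by
  change aeval _ P = _
  rw [aeval_def, eval₂_eq']
  refine Finset.sum_congr rfl fun d _ => ?_
  simp only [← pow_mul, Finset.prod_pow_eq_pow_sum, kroneckerExponent]
  rw [← Polynomial.C_mul_X_pow_eq_monomial]
  rfl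

/-- The entries of `d` are the base 16 digits of its Kronecker exponent. -/
theorem eq_of_kroneckerExponent_eq {d e : PayoffVar →₀ ℕ} (hd : ∀ i, d i < 16)
    (he : ∀ i, e i < 16) (h : kroneckerExponent d = kroneckerExponent e) : d = e := by
  simp only [kroneckerExponent, Fintype.sum_sum_type, Fintype.sum_prod_type, Fin.sum_univ_two,
    payoffIndex, Sum.elim_inl, Sum.elim_inr] at h
  simp at h
  have hd' := hd
  have h1 := hd (Sum.inl (0, 0))
  have h2 := hd (Sum.inl (0, 1))
  have h3 := hd (Sum.inl (1, 0))
  have h4 := hd (Sum.inl (1, 1))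
  have h5 := hd (Sum.inr (0, 0))
  have h6 := hd (Sum.inr (0, 1))
  have h7 := hd (Sum.inr (1, 0))
  have h8 := hd (Sum.inr (1, 1))
  have k1 := he (Sum.inl (0, 0))
  have k2 := he (Sum.inl (0, 1))
  have k3 := he (Sum.inl (1, 0))
  have k4 := he (Sum.inl (1, 1))
  have k5 := he (Sum.inr (0, 0))
  have k6 := he (Sum.inr (0, 1))
  have k7 := he (Sum.inr (1, 0))
  have k8 := he (Sum.inr (1, 1))
  ext i
  obtain ⟨i, j⟩ | ⟨i, j⟩ := i <;> fin_cases i <;> fin_cases j <;> simp <;> omega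

/-- All exponents are below 16, so distinct monomials have distinct images and no terms merge. -/
theorem card_support_kronecker {P : MvPolynomial PayoffVar ℂ} (hP : P.totalDegree < 16) :
    (kronecker P).support.card = P.support.card := by
  have hlt {d : PayoffVar →₀ ℕ} (hd : d ∈ P.support) (i : PayoffVar) : d i < 16 :=
    ((Finsupp.le_degree i d).trans (le_totalDegree hd)).trans_lt hP
  have hinj : Set.InjOn kroneckerExponent (P.support : Set (PayoffVar →₀ ℕ)) :=
    fun d hd e he h => eq_of_kroneckerExponent_eq (hlt hd) (hlt he) h
  have hcoeff {d : PayoffVar →₀ ℕ} (hd : d ∈ P.support) :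
      (kronecker P).coeff (kroneckerExponent d) = P.coeff d := by
    rw [kronecker_eq_sum, Polynomial.finsetSum_coeff, Finset.sum_eq_single_of_mem d hd]
    · rw [Polynomial.coeff_monomial, if_pos rfl]
    · intro e he hne
      rw [Polynomial.coeff_monomial, if_neg fun h => hne (hinj he hd h)]
  have hs : (kronecker P).support = P.support.image kroneckerExponent := by
    ext k
    rw [Finset.mem_image]
    constructor
    · intro hk
      by_contra! hne
      rw [Polynomial.mem_support_iff, kronecker_eq_sum, Polynomial.finsetSum_coeff] at hk
      exact hk (Finset.sum_eq_zero fun d hd => by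
        rw [Polynomial.coeff_monomial, if_neg (hne d hd)])
    · rintro ⟨d, hd, rfl⟩
      rw [Polynomial.mem_support_iff, hcoeff hd]
      exact mem_support_iff.1 hd
  rw [hs, Finset.card_image_of_injOn hinj]

theorem kronecker_spohnPencil (c : ℤ) :
    kronecker (spohnPencil c) = sparseToPolynomial ℂ (sparsePencil c) := by
  have hX (i : PayoffVar) :
      kronecker (X i) = sparseToPolynomial ℂ (sparseVar (payoffIndex i)) := by
    simp [kronecker, sparseVar, sparseToPolynomial_cons, sparseToPolynomial_nil,
      Polynomial.X_pow_eq_monomial]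
  have hC (r : ℂ) : kronecker (C r) = Polynomial.C r := aeval_C _ _
  have hscale (r : ℤ) (l : List (ℕ × ℤ)) : sparseToPolynomial ℂ (sparseScale 0 r l) =
      Polynomial.C (r : ℂ) * sparseToPolynomial ℂ l := by
    rw [sparseToPolynomial_scale, Polynomial.monomial_zero_left]
  have h0 : kronecker (X (Sum.inl (0, 0))) = sparseToPolynomial ℂ (sparseVar 0) := hX _
  have h1 : kronecker (X (Sum.inl (0, 1))) = sparseToPolynomial ℂ (sparseVar 1) := hX _
  have h2 : kronecker (X (Sum.inl (1, 0))) = sparseToPolynomial ℂ (sparseVar 2) := hX _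
  have h3 : kronecker (X (Sum.inl (1, 1))) = sparseToPolynomial ℂ (sparseVar 3) := hX _
  have h4 : kronecker (X (Sum.inr (0, 0))) = sparseToPolynomial ℂ (sparseVar 4) := hX _
  have h5 : kronecker (X (Sum.inr (0, 1))) = sparseToPolynomial ℂ (sparseVar 5) := hX _
  have h6 : kronecker (X (Sum.inr (1, 0))) = sparseToPolynomial ℂ (sparseVar 6) := hX _
  have h7 : kronecker (X (Sum.inr (1, 1))) = sparseToPolynomial ℂ (sparseVar 7) := hX _
  have hQ : kronecker (spohnQuartic genericA genericB) = sparseToPolynomial ℂ sparseQuartic := by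
    simp only [sparseQuartic, sparseToPolynomial_sub, sparseToPolynomial_add,
      sparseToPolynomial_mul, hscale, sparseDiff]
    simp only [spohnQuartic, genericA, genericB, Matrix.of_apply, map_sub, map_add, map_mul,
      map_pow, map_ofNat, h0, h1, h2, h3, h4, h5, h6, h7, Int.cast_ofNat]
    ring
  have hL : kronecker (differenceProduct genericA genericB) =
      sparseToPolynomial ℂ sparseProduct := by
    simp only [sparseProduct, sparseToPolynomial_sub, sparseToPolynomial_mul, sparseDiff]
    simp only [differenceProduct, genericA, genericB, Matrix.of_apply, map_sub, map_mul,
      h0, h1, h2, h3, h4, h5, h6, h7]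
    ring
  rw [spohnPencil, map_add, map_mul, map_pow, hQ, hL, hC,
    sparsePencil, sparseToPolynomial_add, hscale, sparseToPolynomial_mul, sq]

theorem card_support_spohnPencil_48 : (spohnPencil 48).support.card = 633 := by
  have h := sparseCount_sparsePencil
  simp only [Bool.and_eq_true, beq_iff_eq] at h
  rw [← card_support_kronecker
    ((isHomogeneous_spohnPencil 48).totalDegree_le.trans_lt (by norm_num))]
  have hk := kronecker_spohnPencil 48
  rw [Int.cast_ofNat] at hk
  rw [hk, card_support_sparseToPolynomial h.1.1.1, h.1.2]

theorem card_support_spohnPencil_64 : (spohnPencil 64).support.card = 587 := by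
  have h := sparseCount_sparsePencil
  simp only [Bool.and_eq_true, beq_iff_eq] at h
  rw [← card_support_kronecker
    ((isHomogeneous_spohnPencil 64).totalDegree_le.trans_lt (by norm_num))]
  have hk := kronecker_spohnPencil 64
  rw [Int.cast_ofNat] at hk
  rw [hk, card_support_sparseToPolynomial h.1.1.2, h.2]

end SpohnSparse

/-! ### Degrees, factorization and evaluation at given payoffs. -/

section Spohn

theorem spohnAronhold_eq_spohnPencil : spohnAronhold = spohnPencil 48 := by
  rw [spohnAronhold, aronhold_spohnCubic, spohnPencil,
    map_ofNat (C : ℂ →+* MvPolynomial PayoffVar ℂ)]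

theorem payoffSquares_eq : payoffSquares = differenceProduct genericA genericB ^ 2 := by
  have h (x₁ x₂ x₃ x₄ x₅ x₆ x₇ x₈ : MvPolynomial PayoffVar ℂ) :
      x₁ ^ 2 * x₂ ^ 2 * x₃ ^ 2 * x₄ ^ 2 * x₅ ^ 2 * x₆ ^ 2 * x₇ ^ 2 * x₈ ^ 2 =
        (x₂ * x₃ * x₅ * -x₈ * (x₁ * -x₄ * x₆ * -x₇)) ^ 2 := by
    ring
  rw [differenceProduct, ← neg_sub (genericA 1 0) (genericA 1 1),
    ← neg_sub (genericB 1 0) (genericB 1 1), ← neg_sub (genericB 0 1) (genericB 1 1)]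
  exact h _ _ _ _ _ _ _ _

theorem spohnDiscriminant_eq : spohnDiscriminant = payoffSquares * spohnPencil 64 := by
  rw [spohnDiscriminant, cubicDiscriminant_spohnCubic, payoffSquares_eq, spohnPencil,
    map_ofNat (C : ℂ →+* MvPolynomial PayoffVar ℂ)]

theorem totalDegree_payoffSquares : payoffSquares.totalDegree = 16 := by
  have hX {i j : PayoffVar} (h : i ≠ j) :
      (X i - X j : MvPolynomial PayoffVar ℂ).totalDegree = 1 := by
    refine ((isHomogeneous_X ℂ i).sub (isHomogeneous_X ℂ j)).totalDegree fun h0 => ?_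
    exact h (X_injective (sub_eq_zero.1 h0))
  -- Writing degrees as successors makes each factor nonzero, as additivity of degrees requires.
  have hmul {P Q : MvPolynomial PayoffVar ℂ} {m n : ℕ} (hP : P.totalDegree = m + 1)
      (hQ : Q.totalDegree = n + 1) : (P * Q).totalDegree = (m + n + 1) + 1 := by
    rw [totalDegree_mul_of_isDomain, hP, hQ]
    · omega
    · rintro rfl
      simp at hP
    · rintro rfl
      simp at hQ
  have hsq {i j : PayoffVar} (h : i ≠ j) :
      ((X i - X j) ^ 2 : MvPolynomial PayoffVar ℂ).totalDegree = 2 := by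
    rw [sq]
    exact hmul (hX h) (hX h)
  simp only [payoffSquares, genericA, genericB, Matrix.of_apply]
  exact hmul (hmul (hmul (hmul (hmul (hmul (hmul (hsq (by decide)) (hsq (by decide)))
    (hsq (by decide))) (hsq (by decide))) (hsq (by decide))) (hsq (by decide)))
    (hsq (by decide))) (hsq (by decide))

theorem totalDegree_spohnPencil {c : ℂ} (hc : c ≠ 0) : (spohnPencil c).totalDegree = 8 :=
  (isHomogeneous_spohnPencil c).totalDegree (irreducible_spohnPencil hc).ne_zero

theorem evalPayoff_differenceProduct (a b : Matrix (Fin 2) (Fin 2) ℂ) :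
    evalPayoff a b (differenceProduct genericA genericB) = differenceProduct a b := by
  simp [evalPayoff, differenceProduct, genericA, genericB]

theorem evalPayoff_spohnQuartic (a b : Matrix (Fin 2) (Fin 2) ℂ) :
    evalPayoff a b (spohnQuartic genericA genericB) = spohnQuartic a b := by
  simp [evalPayoff, spohnQuartic, genericA, genericB]

theorem evalPayoff_spohnPencil (a b : Matrix (Fin 2) (Fin 2) ℂ) (c : ℂ) :
    evalPayoff a b (spohnPencil c) = spohnQuartic a b ^ 2 + c * differenceProduct a b := by
  rw [← evalPayoff_spohnQuartic, ← evalPayoff_differenceProduct]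
  simp only [evalPayoff, spohnPencil, map_add, map_mul, map_pow, eval_C]

theorem evalPayoff_payoffSquares (a b : Matrix (Fin 2) (Fin 2) ℂ) :
    evalPayoff a b payoffSquares = differenceProduct a b ^ 2 := by
  rw [← evalPayoff_differenceProduct, payoffSquares_eq, evalPayoff, map_pow]
  rfl

theorem evalPayoff_spohnAronhold (a b : Matrix (Fin 2) (Fin 2) ℂ) :
    evalPayoff a b spohnAronhold = aronhold (spohnCubic a b) := by
  rw [spohnAronhold_eq_spohnPencil, evalPayoff_spohnPencil, aronhold_spohnCubic]

theorem evalPayoff_spohnDiscriminant (a b : Matrix (Fin 2) (Fin 2) ℂ) :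
    evalPayoff a b spohnDiscriminant = cubicDiscriminant (spohnCubic a b) := by
  rw [spohnDiscriminant_eq, cubicDiscriminant_spohnCubic, ← evalPayoff_payoffSquares,
    ← evalPayoff_spohnPencil, evalPayoff, map_mul]
  rfl

end Spohn

theorem proposition4p2 :
    (Irreducible spohnAronhold ∧ spohnAronhold.totalDegree = 8 ∧
      spohnAronhold.support.card = 633) ∧
    (spohnDiscriminant.totalDegree = 24 ∧
      ∃ E : MvPolynomial PayoffVar ℂ, Irreducible E ∧ E.totalDegree = 8 ∧ E.support.card = 587 ∧
        spohnDiscriminant = payoffSquares * E) ∧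
    (∀ a b : Matrix (Fin 2) (Fin 2) ℂ,
      (IsSmoothPlaneCurve (spohnCubic a b) ↔ evalPayoff a b spohnDiscriminant ≠ 0) ∧
      (IsSmoothPlaneCurve (spohnCubic a b) → ∀ j : ℂ,
        IsJInvariant (spohnCubic a b) j ↔
          j = evalPayoff a b spohnAronhold ^ 3 / evalPayoff a b spohnDiscriminant)) := by
  have h48 : (48 : ℂ) ≠ 0 := by norm_num
  have h64 : (64 : ℂ) ≠ 0 := by norm_num
  refine ⟨?_, ⟨?_, spohnPencil 64, irreducible_spohnPencil h64, totalDegree_spohnPencil h64,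
    card_support_spohnPencil_64, spohnDiscriminant_eq⟩, fun a b => ?_⟩
  · rw [spohnAronhold_eq_spohnPencil]
    exact ⟨irreducible_spohnPencil h48, totalDegree_spohnPencil h48, card_support_spohnPencil_48⟩
  · have h0 : payoffSquares ≠ 0 := by
      intro h
      have h16 := totalDegree_payoffSquares
      rw [h, totalDegree_zero] at h16
      omega
    rw [spohnDiscriminant_eq,
      totalDegree_mul_of_isDomain h0 (irreducible_spohnPencil h64).ne_zero,
      totalDegree_payoffSquares, totalDegree_spohnPencil h64]
  · rw [evalPayoff_spohnAronhold, evalPayoff_spohnDiscriminant, spohnCubic_eq_ternaryCubic]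
    exact ⟨isSmoothPlaneCurve_ternaryCubic_iff, isJInvariant_ternaryCubic_iff⟩
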